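/- Let $t_0,\dots,t_K$ be treatment levels, let $X$ be a random covariate vector with values in $\mathcal D\subseteq\mathbb R^d$, let $T\in\{t_0,\dots,t_K\}$ be the assigned treatment, and let $r(t,x)=\mathbb P(T=t\mid X=x)$ satisfy $r(t,x)\ge r_{\min}>0$ for all $t$ and all $x\in\mathcal D$. Suppose the potential outcomes are $Y(t)=f(t,X)+\varepsilon(t)$, where the $\varepsilon(t)$ are i.i.d. $\mathcal N(0,\sigma^2)$ and (jointly) independent of $(T,X)$, and $f(t,x)=\sum_{j=0}^{p-1}\beta_{t,j}f_j(x)$ on $\mathcal D$ with measurable basis functions bounded by $|f_j|\le M$ on $\mathcal D$, whose second-moment matrix $F=(\mathbb E[f_jf_{j'}(X)])_{j,j'}$ is invertible with $|(F^{-1})_{jj'}|\le L$. Let $(X_i,T_i,Y_{\mathrm{obs},i})$, $Y_{\mathrm{obs}}=Y(T)$, come from an i.i.d. sample of units, fix $k\in\{1,\dots,K\}$, and put $\beta^*_k=\beta_{t_k}-\beta_{t_0}$ and $\tau_k(x)=\mathbb E[Y(t_k)-Y(t_0)\mid X=x]$. Let $\hat r(t,\cdot)$ and $\hat\mu_t$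 be fixed measurable nuisance functions with $\hat r$ bounded away from $0$ on $\mathcal D$ and $\mathbb E[\hat\mu_t(X)^2]<\infty$, and let $\mathrm{err}(\hat\mu_t)=\mathbb E[(f(t,X)-\hat\mu_t(X))^2]$. Consider the pseudo-outcomes $$Z^M_k=\frac{\mathbf 1\{T=t_k\}}{\hat r(t_k,X)}Y_{\mathrm{obs}}-\frac{\mathbf 1\{T=t_0\}}{\hat r(t_0,X)}Y_{\mathrm{obs}},$$ $$Z^{DR}_k=\frac{Y_{\mathrm{obs}}-\hat\mu_T(X)}{\hat r(t_k,X)}\mathbf 1\{T=t_k\}+\hat\mu_{t_k}(X)-\frac{Y_{\mathrm{obs}}-\hat\mu_T(X)}{\hat r(t_0,X)}\mathbf 1\{T=t_0\}-\hat\mu_{t_0}(X),$$ $$Z^X_k=\mathbf 1\{T=t_k\}(Y_{\mathrm{obs}}-\hat\mu_{t_0}(X))+\sum_{l\ne k}\mathbf 1\{T=t_l\}(\hat\mu_{t_k}(X)-Y_{\mathrm{obs}})+\sum_{l\neq k}\mathbf 1\{T=t_l\}(\hat\mu_{t_l}(X)-\hat\mu_{t_0}(X)).$$ The nuisance functions are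 called well-specified for a learner if $\mathbb E[Z_k\mid X]=\tau_k(X)$ almost surely. This holds for the M- and DR-learners if $\hat r(t,X)=r(t,X)$ a.s. for all $t$, and for the DR- and X-learners if $\hat\mu_t(X)=f(t,X)$ a.s. for all $t$. For each learner, let $\hat\beta^*_k=(H^\top H)^{-1}H^\top z_k$ be the OLS estimator obtained by regressing $Z_{k,1},\dots,Z_{k,n}$ on $H=(f_j(X_i))_{ij}$. There are matrices $C$, one for each learner, such that, if the nuisance functions are well-specified for the learner, then: 1. $\hat\beta^*_k$ is unbiased where $H$ has full column rank. That is, $\mathbb E[\hat\beta^*_k\mathbf 1_S]=\mathbb P(S)\,\beta^*_k$ for every event $S$ determined by $X_1,\dots,X_n$ on which $H$ has full column rank and $\hat\beta^*_k$ is integrable (which it is on each event $\{\det H^\top H\ge\delta\}$, $\delta>0$). In particular $\mathbb E[\hat\beta^*_k]=\beta^*_k$ if $H$ has full column rank a.s. and the mean exists. 2. $\hat\beta^*_k$ has asymptotic covariance matrix $C/n$: $C$ is positive semidefinite and $\sqrt n(\hat\beta^*_k-\beta^*_k)$ converges in distribution to $\mathcal N(0,C)$. Moreover, for every $\epsilon>0$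 there is a constant $c$ depending only on $p,M,L,\epsilon$ such that, for all $i,j$, - M-learner, if $\hat r(t,X)=r(t,X)$ a.s. for all $t$ and $|f(t,x)|\le B$ for all $t$ and all $x\in\mathcal D$: $\displaystyle |C_{ij}|\le c\,\frac{B^2+\sigma^2}{r_{\min}^{1+\epsilon}}$; - DR-learner, if $\hat r(t,X)=r(t,X)$ a.s. for all $t$ ($\hat\mu$ arbitrary): $\displaystyle |C_{ij}|\le c\,\frac{\mathrm{err}(\hat\mu_{t_k})+\mathrm{err}(\hat\mu_{t_0})+\sigma^2}{r_{\min}^{1+\epsilon}}$; - X-learner, if the nuisance functions are well-specified for it: $\displaystyle |C_{ij}|\le c\Big(K^2\sum_{l\ne k}\mathrm{err}(\hat\mu_{t_l})+\mathrm{err}(\hat\mu_{t_k})+\sigma^2\Big)$. -/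

import Mathlib

open MeasureTheory ProbabilityTheory Filter Topology
open scoped NNReal

namespace MultiTreatment

noncomputable section

/-- The covariate space `ℝ^d`. -/
abbrev Covariate (d : ℕ) := EuclideanSpace ℝ (Fin d)

/-! ### Outcomes

The treatment levels `t_0, …, t_K` are represented by their indices `0, …, K`. -/

/-- The potential outcome `Y_i(t) = f(t, X_i) + ε_i(t)` of unit `i`. -/
def potentialOutcome {Ω : Type*} {d K : ℕ} (f : Fin (K + 1) → Covariate d → ℝ)
    (X : ℕ → Ω → Covariate d) (noise : ℕ → Fin (K + 1) → Ω → ℝ)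
    (i : ℕ) (t : Fin (K + 1)) (ω : Ω) : ℝ :=
  f t (X i ω) + noise i t ω

/-- The observed outcome `Y_obs,i = Y_i(T_i)`. -/
def observedOutcome {Ω : Type*} {d K : ℕ} (f : Fin (K + 1) → Covariate d → ℝ)
    (X : ℕ → Ω → Covariate d) (T : ℕ → Ω → Fin (K + 1)) (noise : ℕ → Fin (K + 1) → Ω → ℝ)
    (i : ℕ) (ω : Ω) : ℝ :=
  potentialOutcome f X noise i (T i ω) ω

/-- The statistical model: the units `(X_i, T_i, (ε_i(t))_t)` are i.i.d., the noises `ε_i(t)` are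
independent `N(0, σ²)` variables, jointly independent of `(X_i, T_i)`, `r` is the generalized
propensity score and is bounded below by `rmin > 0` on the domain `D` of the covariates, and
`f(t, x) = ∑ j, β_{t,j} φ_j(x)` on `D`. -/
structure LinearModel {Ω : Type*} [MeasurableSpace Ω] (P : Measure Ω) {d K p : ℕ}
    (D : Set (Covariate d)) (X : ℕ → Ω → Covariate d) (T : ℕ → Ω → Fin (K + 1))
    (noise : ℕ → Fin (K + 1) → Ω → ℝ) (σ : ℝ≥0)
    (r : Fin (K + 1) → Covariate d → ℝ) (rmin : ℝ)
    (f : Fin (K + 1) → Covariate d → ℝ) (φ : Fin p → Covariate d → ℝ)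
    (β : Fin (K + 1) → Fin p → ℝ) : Prop where
  measurable_X : ∀ i, Measurable (X i)
  measurable_T : ∀ i, Measurable (T i)
  measurable_noise : ∀ i t, Measurable (noise i t)
  measurable_r : ∀ t, Measurable (r t)
  measurable_φ : ∀ j, Measurable (φ j)
  mem_D : ∀ i, ∀ᵐ ω ∂P, X i ω ∈ D
  indep : iIndepFun (fun i ω => (X i ω, T i ω, fun t => noise i t ω)) P
  ident : ∀ i, IdentDistrib (fun ω => (X i ω, T i ω, fun t => noise i t ω))
    (fun ω => (X 0 ω, T 0 ω, fun t => noise 0 t ω)) P P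
  noise_law : ∀ t, HasLaw (noise 0 t) (gaussianReal 0 (σ ^ 2)) P
  noise_indep : iIndepFun (fun t => noise 0 t) P
  noise_indep_XT : IndepFun (fun ω => (X 0 ω, T 0 ω)) (fun ω t => noise 0 t ω) P
  gps : ∀ t, P[Set.indicator {ω | T 0 ω = t} (fun _ => (1 : ℝ)) |
      MeasurableSpace.comap (X 0) inferInstance] =ᵐ[P] fun ω => r t (X 0 ω)
  rmin_pos : 0 < rmin
  overlap : ∀ t, ∀ x ∈ D, rmin ≤ r t x
  linear : ∀ t, ∀ x ∈ D, f t x = ∑ j, β t j * φ j x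

/-- Fixed candidates `rhat` and `muhat` for the nuisance functions `r` and `f`: measurable, with
`rhat` bounded away from zero and `muhat_t(X)` square integrable. -/
structure Nuisance {Ω : Type*} [MeasurableSpace Ω] (P : Measure Ω) {d K : ℕ}
    (D : Set (Covariate d)) (X : ℕ → Ω → Covariate d)
    (rhat muhat : Fin (K + 1) → Covariate d → ℝ) : Prop where
  measurable_rhat : ∀ t, Measurable (rhat t)
  measurable_muhat : ∀ t, Measurable (muhat t)
  overlap : ∃ ρ : ℝ, 0 < ρ ∧ ∀ t, ∀ x ∈ D, ρ ≤ rhat t x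
  memLp : ∀ t, MemLp (fun ω => muhat t (X 0 ω)) 2 P

/-- The expected mean squared error `err(muhat_t) = E[(f(t, X) - muhat_t(X))²]`. -/
def err {Ω : Type*} [MeasurableSpace Ω] (P : Measure Ω) {d K : ℕ} (X : ℕ → Ω → Covariate d)
    (f muhat : Fin (K + 1) → Covariate d → ℝ) (t : Fin (K + 1)) : ℝ :=
  ∫ ω, (f t (X 0 ω) - muhat t (X 0 ω)) ^ 2 ∂P

/-! ### Pseudo-outcomes -/

/-- The three pseudo-outcome meta-learners. -/
inductive Learner
  | M
  | DR
  | X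

/-- The indicator `1{T = t}`. -/
def ind {K : ℕ} (T t : Fin (K + 1)) : ℝ := if T = t then 1 else 0

/-- The pseudo-outcome `Z_k` of each learner, as a function of `(X, T, Y_obs) = (x, T, y)`. -/
def pseudoOutcome {d K : ℕ} (rhat muhat : Fin (K + 1) → Covariate d → ℝ) (k : Fin (K + 1)) :
    Learner → Covariate d → Fin (K + 1) → ℝ → ℝ
  | .M, x, T, y => ind T k / rhat k x * y - ind T 0 / rhat 0 x * y
  | .DR, x, T, y =>
      (y - muhat T x) / rhat k x * ind T k + muhat k x
        - (y - muhat T x) / rhat 0 x * ind T 0 - muhat 0 x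
  | .X, x, T, y =>
      ind T k * (y - muhat 0 x)
        + (∑ l ∈ Finset.univ.erase k, ind T l) * (muhat k x - y)
        + ∑ l ∈ Finset.univ.erase k, ind T l * (muhat l x - muhat 0 x)

/-- The pseudo-outcome `Z_{k,i}` of unit `i`. -/
def Z {Ω : Type*} {d K : ℕ} (f : Fin (K + 1) → Covariate d → ℝ)
    (X : ℕ → Ω → Covariate d) (T : ℕ → Ω → Fin (K + 1)) (noise : ℕ → Fin (K + 1) → Ω → ℝ)
    (rhat muhat : Fin (K + 1) → Covariate d → ℝ) (k : Fin (K + 1)) (ℓ : Learner)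
    (i : ℕ) (ω : Ω) : ℝ :=
  pseudoOutcome rhat muhat k ℓ (X i ω) (T i ω) (observedOutcome f X T noise i ω)

/-- The nuisance functions are well-specified for the learner `ℓ`: the pseudo-outcome identifies
the conditional average treatment effect, `E[Z_k | X] = τ_k(X) = E[Y(t_k) - Y(t_0) | X]`. -/
def WellSpecified {Ω : Type*} [MeasurableSpace Ω] (P : Measure Ω) {d K : ℕ}
    (f : Fin (K + 1) → Covariate d → ℝ)
    (X : ℕ → Ω → Covariate d) (T : ℕ → Ω → Fin (K + 1)) (noise : ℕ → Fin (K + 1) → Ω → ℝ)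
    (rhat muhat : Fin (K + 1) → Covariate d → ℝ) (k : Fin (K + 1)) (ℓ : Learner) : Prop :=
  P[Z f X T noise rhat muhat k ℓ 0 | MeasurableSpace.comap (X 0) inferInstance] =ᵐ[P]
    P[fun ω => potentialOutcome f X noise 0 k ω - potentialOutcome f X noise 0 0 ω |
      MeasurableSpace.comap (X 0) inferInstance]

/-! ### Ordinary least squares -/

/-- The regression matrix `H_{ij} = φ_j(x_i)`. -/
def regressionMatrix {d p n : ℕ} (φ : Fin p → Covariate d → ℝ) (x : Fin n → Covariate d) :
    Matrix (Fin n) (Fin p) ℝ :=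
  Matrix.of fun i j => φ j (x i)

/-- The matrix `Hᵀ H`. It is invertible exactly when `H` has full column rank. -/
def gram {d p n : ℕ} (φ : Fin p → Covariate d → ℝ) (x : Fin n → Covariate d) :
    Matrix (Fin p) (Fin p) ℝ :=
  (regressionMatrix φ x).transpose * regressionMatrix φ x

/-- The OLS coefficients `(Hᵀ H)⁻¹ Hᵀ z`. -/
def ols {d p n : ℕ} (φ : Fin p → Covariate d → ℝ) (x : Fin n → Covariate d) (z : Fin n → ℝ) :
    Fin p → ℝ :=
  (gram φ x)⁻¹.mulVec ((regressionMatrix φ x).transpose.mulVec z)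

/-- The covariates of the first `n` units. -/
def design {Ω : Type*} {d : ℕ} (X : ℕ → Ω → Covariate d) (n : ℕ) (ω : Ω) : Fin n → Covariate d :=
  fun i => X i ω

/-- The OLS estimator obtained by regressing `Z_{k,1}, …, Z_{k,n}` on the basis functions. -/
def betaHat {Ω : Type*} {d K p : ℕ} (f : Fin (K + 1) → Covariate d → ℝ)
    (φ : Fin p → Covariate d → ℝ)
    (X : ℕ → Ω → Covariate d) (T : ℕ → Ω → Fin (K + 1)) (noise : ℕ → Fin (K + 1) → Ω → ℝ)
    (rhat muhat : Fin (K + 1) → Covariate d → ℝ) (k : Fin (K + 1)) (ℓ : Learner)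
    (n : ℕ) (ω : Ω) : Fin p → ℝ :=
  ols φ (design X n ω) fun i => Z f X T noise rhat muhat k ℓ i ω

/-- The population second moment matrix `F_{jj'} = E[φ_j(X) φ_{j'}(X)]`. -/
def secondMoment {Ω : Type*} [MeasurableSpace Ω] (P : Measure Ω) {d p : ℕ}
    (φ : Fin p → Covariate d → ℝ) (X : ℕ → Ω → Covariate d) : Matrix (Fin p) (Fin p) ℝ :=
  Matrix.of fun j j' => ∫ ω, φ j (X 0 ω) * φ j' (X 0 ω) ∂P

/-- Finite-sample unbiasedness of a sequence of regression estimators `est n` of `b`.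

The regression matrix is required to have full rank. Since `E |est n|` may be infinite when
`Hᵀ H` can be arbitrarily close to singular, unbiasedness is stated conditionally on the
covariates as well, by integrating over events determined by them: `est n` is integrable wherever
`det (Hᵀ H)` is bounded below, its mean over every set `S` of full rank designs over which it is
integrable is `b`, and in particular its mean is `b` when the design has full rank almost surely
and the mean exists. -/
structure Unbiased {Ω : Type*} [MeasurableSpace Ω] (P : Measure Ω) {d p : ℕ}
    (φ : Fin p → Covariate d → ℝ) (X : ℕ → Ω → Covariate d)
    (est : ℕ → Ω → Fin p → ℝ) (b : Fin p → ℝ) : Prop where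
  integrableOn : ∀ (n : ℕ) (δ : ℝ), 0 < δ → ∀ j,
    IntegrableOn (fun ω => est n ω j) {ω | δ ≤ (gram φ (design X n ω)).det} P
  conditional : ∀ (n : ℕ) (S : Set (Fin n → Covariate d)), MeasurableSet S →
    (∀ x ∈ S, (gram φ x).det ≠ 0) → ∀ j,
    IntegrableOn (fun ω => est n ω j) {ω | design X n ω ∈ S} P →
    ∫ ω in {ω | design X n ω ∈ S}, est n ω j ∂P = P.real {ω | design X n ω ∈ S} * b j
  mean : ∀ n : ℕ, (∀ᵐ ω ∂P, (gram φ (design X n ω)).det ≠ 0) → ∀ j,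
    Integrable (fun ω => est n ω j) P → ∫ ω, est n ω j ∂P = b j

/-- `est n` is asymptotically normal around `b` with asymptotic covariance matrix `C / n`:
`√n (est n - b)` converges in distribution to `N(0, C)`. -/
def HasAsymptoticCovariance {Ω : Type*} [MeasurableSpace Ω] (P : Measure Ω)
    [IsProbabilityMeasure P] {p : ℕ}
    (est : ℕ → Ω → Fin p → ℝ) (b : Fin p → ℝ) (C : Matrix (Fin p) (Fin p) ℝ) : Prop :=
  C.PosSemidef ∧
    TendstoInDistribution
      (fun (n : ℕ) ω => (WithLp.toLp 2 fun j => √(n : ℝ) * (est n ω j - b j) :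
        EuclideanSpace ℝ (Fin p)))
      atTop (id : EuclideanSpace ℝ (Fin p) → EuclideanSpace ℝ (Fin p)) (fun _ => P)
      (multivariateGaussian 0 C)

end

end MultiTreatment

/-! On `D` each pseudo-outcome splits as `Z = ∑ j, φ_j(X) (β_k - β_0)_j + R`, and well-specification
says exactly that `E[R | X] = 0` (`wellSpecified_iff`). Both claims are therefore facts about least
squares with i.i.d. pairs `(X_i, R_i)` and errors that are centered given `X`, possibly
heteroskedastic; `CenteredErrors` records this setting.

Unbiasedness: for a design of full rank the estimation error is `(HᵀH)⁻¹Hᵀ R`. The weights depend on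
the covariates alone, and each `R_i` has mean zero given all covariates
(`integral_design_mul_eq_zero`). A truncation of the weights reduces to the case where every term is
integrable.

Asymptotics: `√n (est - b) = (HᵀH/n)⁻¹ F · n^(-1/2) ∑ F⁻¹ φ(X_i) R_i` (`sqrt_mul_ols_sub`). The
matrix factor tends to the identity by the law of large numbers, the sum is Gaussian in the limit by
the central limit theorem, and Slutsky's theorem combines the two. So `C` is the second moment
matrix of `F⁻¹ φ(X) R`, whence `|C_ij| ≤ (pLM)² E[R²]`.

It remains to bound `E[R²]` for each learner. Inverse weights enter squared, but averaging over the
treatment supplies one factor `r`, leaving `1/r ≤ 1/rmin` (`integral_outcomeCoeff_sq_mul_le`). The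
X-learner multiplies the outcome by `±1` only, so no weight appears. The bounds obtained have
exponent `1` in place of `1 + ε` and no factor `K²`; the stated ones follow from `rmin ≤ 1` and `K ≥
1`, and the constant does not involve `ε`. -/

namespace MultiTreatment

/-! ### Multivariate central limit theorem -/

section CentralLimit

variable {Ω : Type*} [MeasurableSpace Ω] {P : Measure Ω} {p : ℕ}

/-- The matrix of the products `E[V_i V_j]` of the coordinates of a random vector `V`. -/
noncomputable def momentMatrix (P : Measure Ω) (V : Ω → Fin p → ℝ) : Matrix (Fin p) (Fin p) ℝ :=
  Matrix.of fun i j => ∫ ω, V ω i * V ω j ∂P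

theorem dotProduct_momentMatrix_mulVec {V : Ω → Fin p → ℝ}
    (hV : ∀ i, MemLp (fun ω => V ω i) 2 P) (t : Fin p → ℝ) :
    t ⬝ᵥ (momentMatrix P V).mulVec t = ∫ ω, (∑ i, t i * V ω i) ^ 2 ∂P := by
  have hint : ∀ i j, Integrable (fun ω => V ω i * V ω j) P := fun i j =>
    (hV i).integrable_mul (hV j)
  have key : ∀ ω, (∑ i, t i * V ω i) ^ 2 = ∑ i, ∑ j, t i * t j * (V ω i * V ω j) := fun ω => by
    rw [sq, Finset.sum_mul_sum]
    exact Finset.sum_congr rfl fun i _ => Finset.sum_congr rfl fun j _ => by ring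
  simp_rw [key]
  rw [integral_finsetSum _ fun i _ => integrable_finsetSum _ fun j _ => (hint i j).const_mul _]
  simp_rw [dotProduct, Matrix.mulVec, dotProduct, Finset.mul_sum]
  refine Finset.sum_congr rfl fun i _ => ?_
  rw [integral_finsetSum _ fun j _ => (hint i j).const_mul _]
  refine Finset.sum_congr rfl fun j _ => ?_
  rw [integral_const_mul, momentMatrix, Matrix.of_apply]
  ring

theorem posSemidef_momentMatrix {V : Ω → Fin p → ℝ} (hV : ∀ i, MemLp (fun ω => V ω i) 2 P) :
    (momentMatrix P V).PosSemidef := by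
  refine Matrix.PosSemidef.of_dotProduct_mulVec_nonneg ?_ fun t => ?_
  · ext i j
    simp only [momentMatrix, Matrix.conjTranspose_apply, Matrix.of_apply, star_trivial]
    exact integral_congr_ae (.of_forall fun ω => mul_comm _ _)
  · rw [star_trivial, dotProduct_momentMatrix_mulVec hV]
    exact integral_nonneg fun ω => sq_nonneg _

/-- Cramér–Wold: the characteristic function of the vector sum at `t` is that of the real sum of the
`⟨t, V_n⟩` at `1`. The one-dimensional theorem applies to the latter, whose variance is the
quadratic form of the moment matrix at `t`. -/
theorem tendstoInDistribution_multivariateGaussian [IsProbabilityMeasure P]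
    {V : ℕ → Ω → Fin p → ℝ} (hindep : iIndepFun V P)
    (hident : ∀ n, IdentDistrib (V n) (V 0) P P)
    (hV : ∀ i, MemLp (fun ω => V 0 ω i) 2 P) (h0 : ∀ i, ∫ ω, V 0 ω i ∂P = 0) :
    TendstoInDistribution
      (fun (n : ℕ) ω => (WithLp.toLp 2 fun j => (√(n : ℝ))⁻¹ * ∑ k ∈ Finset.range n, V k ω j :
        EuclideanSpace ℝ (Fin p)))
      atTop (id : EuclideanSpace ℝ (Fin p) → EuclideanSpace ℝ (Fin p)) (fun _ => P)
      (multivariateGaussian 0 (momentMatrix P (V 0))) := by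
  have hmeas : ∀ n : ℕ, AEMeasurable (fun ω => (WithLp.toLp 2 fun j => (√(n : ℝ))⁻¹ *
      ∑ k ∈ Finset.range n, V k ω j : EuclideanSpace ℝ (Fin p))) P := fun n => by
    refine (WithLp.measurable_toLp 2 (Fin p → ℝ)).comp_aemeasurable
      (aemeasurable_pi_lambda _ fun j => ?_)
    refine AEMeasurable.const_mul (Finset.aemeasurable_fun_sum _ fun k _ => ?_) _
    exact (measurable_pi_apply j).comp_aemeasurable (hident k).aemeasurable_fst
  refine ⟨hmeas, by fun_prop, ProbabilityMeasure.tendsto_iff_tendsto_charFun.2 fun t => ?_⟩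
  have hlin : Measurable fun v : Fin p → ℝ => ∑ i, t i * v i := by fun_prop
  set Y : ℕ → Ω → ℝ := fun n ω => ∑ i, t i * V n ω i with hY
  have hYi : iIndepFun Y P := hindep.comp (fun _ v => ∑ i, t i * v i) fun _ => hlin
  have hYd : ∀ n, IdentDistrib (Y n) (Y 0) P P := fun n => (hident n).comp hlin
  have hY2 : MemLp (Y 0) 2 P := memLp_finsetSum _ fun i _ => (hV i).const_mul _
  have hYm : ∫ ω, Y 0 ω ∂P = 0 := by
    simp only [hY]
    rw [integral_finsetSum _ fun i _ => ((hV i).integrable (by norm_num)).const_mul _]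
    simp [integral_const_mul, h0]
  have hvar : Var[Y 0; P] = t ⬝ᵥ (momentMatrix P (V 0)).mulVec t := by
    rw [variance_of_integral_eq_zero hY2.aestronglyMeasurable.aemeasurable hYm,
      dotProduct_momentMatrix_mulVec hV]
  have hclt := tendstoInDistribution_inv_sqrt_mul_sum_sub
    (P' := gaussianReal 0 Var[Y 0; P].toNNReal) (Y := id) HasLaw.id hY2 hYi hYd
  have hlim := ProbabilityMeasure.tendsto_iff_tendsto_charFun.1 hclt.tendsto 1
  simp only [ProbabilityMeasure.coe_mk, Measure.map_id] at hlim ⊢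
  have hpos := posSemidef_momentMatrix hV
  rw [charFun_multivariateGaussian hpos]
  rw [charFun_gaussianReal] at hlim
  convert hlim using 2 with n
  · have h1 : AEMeasurable (fun ω => (√(n : ℝ))⁻¹ * (∑ k ∈ Finset.range n, Y k ω - n * P[Y 0])) P :=
      hclt.forall_aemeasurable n
    rw [charFun_apply, charFun_apply, integral_map (hmeas n) (by fun_prop),
      integral_map h1 (by fun_prop)]
    refine integral_congr_ae (.of_forall fun ω => ?_)
    have : inner ℝ (WithLp.toLp 2 fun j => (√(n : ℝ))⁻¹ * ∑ k ∈ Finset.range n, V k ω j :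
        EuclideanSpace ℝ (Fin p)) t =
        (√(n : ℝ))⁻¹ * (∑ k ∈ Finset.range n, Y k ω - n * P[Y 0]) := by
      rw [hYm, mul_zero, sub_zero, PiLp.inner_apply]
      simp only [hY, RCLike.inner_apply, conj_trivial]
      rw [Finset.sum_comm, Finset.mul_sum]
      refine Finset.sum_congr rfl fun i _ => ?_
      rw [Finset.mul_sum, Finset.mul_sum, Finset.mul_sum]
      exact Finset.sum_congr rfl fun k _ => by ring
    simp only [this, RCLike.inner_apply, conj_trivial, one_mul]
  · have hnn : 0 ≤ t ⬝ᵥ (momentMatrix P (V 0)).mulVec t := hvar ▸ variance_nonneg _ _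
    simp [hvar, max_eq_left hnn]

end CentralLimit

/-! ### Algebra, measurability and bounds for least squares -/

section LeastSquares

variable {d p n : ℕ} {φ : Fin p → Covariate d → ℝ}

/-- The matrix `(Hᵀ H)⁻¹ Hᵀ` of the least squares estimator. -/
noncomputable def olsWeight (φ : Fin p → Covariate d → ℝ) (x : Fin n → Covariate d) :
    Matrix (Fin p) (Fin n) ℝ :=
  (gram φ x)⁻¹ * (regressionMatrix φ x).transpose

theorem ols_eq_olsWeight_mulVec (x : Fin n → Covariate d) (z : Fin n → ℝ) :
    ols φ x z = (olsWeight φ x).mulVec z := by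
  simp [ols, olsWeight, Matrix.mulVec_mulVec]

/-- For a design of full rank `(HᵀH)⁻¹Hᵀ` is a left inverse of `H`, so the estimation error is the
same linear map applied to the errors alone. -/
theorem ols_linear_add {x : Fin n → Covariate d} (hx : (gram φ x).det ≠ 0) (b : Fin p → ℝ)
    (v : Fin n → ℝ) :
    ols φ x (fun i => ∑ j, φ j (x i) * b j + v i) = b + ols φ x v := by
  have h : (fun i => ∑ j, φ j (x i) * b j + v i) = (regressionMatrix φ x).mulVec b + v := rfl
  rw [h, ols_eq_olsWeight_mulVec, ols_eq_olsWeight_mulVec, Matrix.mulVec_add,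
    Matrix.mulVec_mulVec, olsWeight, Matrix.mul_assoc]
  change ((gram φ x)⁻¹ * gram φ x).mulVec b + _ = _
  rw [Matrix.nonsing_inv_mul _ (isUnit_iff_ne_zero.2 hx), Matrix.one_mulVec]

theorem gram_apply (x : Fin n → Covariate d) (j j' : Fin p) :
    gram φ x j j' = ∑ i, φ j (x i) * φ j' (x i) := rfl

theorem continuous_adjugate_apply (i j : Fin p) :
    Continuous fun A : Fin p → Fin p → ℝ => (Matrix.of A).adjugate i j :=
  (continuous_id.matrix_adjugate (A := fun A : Matrix (Fin p) (Fin p) ℝ => A)).matrix_elem i j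

theorem continuous_det_of : Continuous fun A : Fin p → Fin p → ℝ => (Matrix.of A).det :=
  (continuous_id.matrix_det (A := fun A : Matrix (Fin p) (Fin p) ℝ => A))

/-- Cramer's rule, valid for singular matrices too, where both sides are zero. Inversion is thus
measurable on all matrices, with no restriction to invertible ones. -/
theorem inv_apply_eq (A : Matrix (Fin p) (Fin p) ℝ) (i j : Fin p) :
    A⁻¹ i j = A.det⁻¹ * A.adjugate i j := by
  rw [Matrix.inv_def, Matrix.smul_apply, Ring.inverse_eq_inv', smul_eq_mul]

theorem measurable_inv_apply {α : Type*} [MeasurableSpace α] {A : α → Matrix (Fin p) (Fin p) ℝ}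
    (hA : Measurable fun a => fun j j' => A a j j') (i j : Fin p) :
    Measurable fun a => (A a)⁻¹ i j := by
  simp only [inv_apply_eq]
  exact (continuous_det_of.measurable.comp hA).inv.mul
    ((continuous_adjugate_apply i j).measurable.comp hA)

variable (hφ : ∀ j, Measurable (φ j))
include hφ

theorem measurable_gram :
    Measurable fun x : Fin n → Covariate d => fun j j' => gram φ x j j' := by
  refine measurable_pi_lambda _ fun j => measurable_pi_lambda _ fun j' => ?_
  simp only [gram_apply]
  exact Finset.measurable_fun_sum _ fun i _ =>
    ((hφ j).comp (measurable_pi_apply i)).mul ((hφ j').comp (measurable_pi_apply i))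

theorem measurable_det_gram : Measurable fun x : Fin n → Covariate d => (gram φ x).det :=
  continuous_det_of.measurable.comp (measurable_gram hφ)

theorem measurable_olsWeight (j : Fin p) (i : Fin n) :
    Measurable fun x : Fin n → Covariate d => olsWeight φ x j i := by
  simp only [olsWeight, Matrix.mul_apply]
  exact Finset.measurable_fun_sum _ fun l _ => (measurable_inv_apply (measurable_gram hφ) j l).mul
    ((hφ l).comp (measurable_pi_apply i))

omit hφ

/-- By Cramer's rule the inverse is the adjugate over a determinant that is at least `δ`, and
adjugate entries are determinants of matrices with bounded entries. -/
theorem exists_olsWeight_bound {M δ : ℝ} (hδ : 0 < δ) : ∃ c : ℝ, ∀ x : Fin n → Covariate d,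
    (∀ j i, |φ j (x i)| ≤ M) → δ ≤ (gram φ x).det → ∀ j i, |olsWeight φ x j i| ≤ c := by
  -- The maximum with `1` covers the unit row that the adjugate substitutes into the Gram matrix.
  set B : ℝ := max (n * (|M| * |M|)) 1
  set a : ℝ := (Fintype.card (Fin p)).factorial • B ^ Fintype.card (Fin p)
  refine ⟨p * (δ⁻¹ * a * |M|), fun x hx hdet j i => ?_⟩
  have hx' : ∀ j i, |φ j (x i)| ≤ |M| := fun j i => (hx j i).trans (le_abs_self M)
  have hgram : ∀ j j', |gram φ x j j'| ≤ B := fun j j' => by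
    rw [gram_apply]
    refine (Finset.abs_sum_le_sum_abs _ _).trans (le_trans ?_ (le_max_left _ _))
    calc ∑ i, |φ j (x i) * φ j' (x i)| ≤ ∑ i : Fin n, |M| * |M| :=
          Finset.sum_le_sum fun i _ => by
            rw [abs_mul]; exact mul_le_mul (hx' _ _) (hx' _ _) (abs_nonneg _) (abs_nonneg _)
      _ = n * (|M| * |M|) := by simp
  have hadj : ∀ j l, |(gram φ x).adjugate j l| ≤ a := fun j l => by
    rw [Matrix.adjugate_apply]
    refine Matrix.det_le (abv := AbsoluteValue.abs) fun u v => ?_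
    rw [Matrix.updateRow_apply, AbsoluteValue.abs_apply]
    split_ifs
    · refine le_trans ?_ (le_max_right _ _)
      rw [Pi.single_apply]
      split_ifs <;> simp
    · exact hgram _ _
  have ha : 0 ≤ a := by positivity
  rw [olsWeight, Matrix.mul_apply]
  refine (Finset.abs_sum_le_sum_abs _ _).trans ?_
  calc ∑ l, |(gram φ x)⁻¹ j l * (regressionMatrix φ x).transpose l i|
      ≤ ∑ l : Fin p, δ⁻¹ * a * |M| := Finset.sum_le_sum fun l _ => by
        rw [abs_mul, inv_apply_eq, abs_mul, abs_inv, abs_of_pos (hδ.trans_le hdet)]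
        refine mul_le_mul (mul_le_mul (inv_anti₀ hδ hdet) (hadj _ _) (abs_nonneg _)
          (by positivity)) (hx' _ _) (abs_nonneg _) (by positivity)
    _ = p * (δ⁻¹ * a * |M|) := by simp

end LeastSquares

/-! ### Regression errors centered given the covariates -/

section Errors

variable {Ω : Type*} [MeasurableSpace Ω] {P : Measure Ω} {d p : ℕ}
  {φ : Fin p → Covariate d → ℝ} {X : ℕ → Ω → Covariate d} {R : ℕ → Ω → ℝ}

/-- The pairs `(X_i, R_i)` of covariates and regression errors are i.i.d., with square integrable
errors that satisfy `E[R | X] = 0`. -/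
structure CenteredErrors (P : Measure Ω) (X : ℕ → Ω → Covariate d) (R : ℕ → Ω → ℝ) : Prop where
  measurable_X : ∀ i, Measurable (X i)
  measurable_R : ∀ i, Measurable (R i)
  indep : iIndepFun (fun i ω => (X i ω, R i ω)) P
  ident : ∀ i, IdentDistrib (fun ω => (X i ω, R i ω)) (fun ω => (X 0 ω, R 0 ω)) P P
  memLp : MemLp (R 0) 2 P
  condExp_eq_zero : P[R 0 | MeasurableSpace.comap (X 0) inferInstance] =ᵐ[P] 0

namespace CenteredErrors

theorem identDistrib_X (h : CenteredErrors P X R) (i : ℕ) : IdentDistrib (X i) (X 0) P P :=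
  (h.ident i).comp measurable_fst

variable [IsProbabilityMeasure P]

theorem integrable_R (h : CenteredErrors P X R) (i : ℕ) : Integrable (R i) P :=
  ((h.ident i).comp measurable_snd).symm.integrable_snd (h.memLp.integrable (by norm_num))

theorem integral_mul_eq_zero (h : CenteredErrors P X R) {g : Covariate d → ℝ} (hg : Measurable g)
    (hint : Integrable (fun ω => g (X 0 ω) * R 0 ω) P) : ∫ ω, g (X 0 ω) * R 0 ω ∂P = 0 := by
  have hle := (h.measurable_X 0).comap_le
  have hgm : StronglyMeasurable[MeasurableSpace.comap (X 0) inferInstance] fun ω => g (X 0 ω) :=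
    (hg.comp (comap_measurable (X 0))).stronglyMeasurable
  have hpull := condExp_mul_of_stronglyMeasurable_left hgm hint (h.integrable_R 0)
  calc ∫ ω, g (X 0 ω) * R 0 ω ∂P
      = ∫ ω, (P[(fun ω => g (X 0 ω)) * R 0 | MeasurableSpace.comap (X 0) inferInstance]) ω ∂P :=
        (integral_condExp hle).symm
    _ = ∫ ω, 0 ∂P := by
        refine integral_congr_ae ?_
        filter_upwards [hpull, h.condExp_eq_zero] with ω h1 h2
        rw [h1, Pi.mul_apply, h2]
        simp
    _ = 0 := integral_zero _ _

/-- The factor `a` involves `X_i` as well as the other covariates. Since unit `i` is independent of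
the others, Fubini allows them to be frozen at `w`; what remains is a function of `X_i` times `R_i`,
which integrates to zero because `E[R | X] = 0`. -/
theorem integral_design_mul_eq_zero (h : CenteredErrors P X R) {n : ℕ} (i : Fin n)
    {a : (Fin n → Covariate d) → ℝ} (ha : Measurable a)
    (hint : Integrable (fun ω => a (design X n ω) * R i ω) P) :
    ∫ ω, a (design X n ω) * R i ω ∂P = 0 := by
  classical
  have hpair : ∀ i, Measurable fun ω => (X i ω, R i ω) := fun i =>
    (h.measurable_X i).prodMk (h.measurable_R i)
  set T : Finset ℕ := (Finset.range n).erase i with hT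
  -- The design with coordinate `i` blanked out, hence a function of the other units;
  -- `Function.update` restores the coordinate.
  set rest : Ω → Fin n → Covariate d := fun ω j => if (j : ℕ) ∈ T then X j ω else 0 with hrest
  have hrm : Measurable rest := measurable_pi_lambda _ fun j => by
    by_cases hj : (j : ℕ) ∈ T
    · simpa only [hrest, if_pos hj] using h.measurable_X j
    · simp only [hrest, if_neg hj, measurable_const]
  have hind : IndepFun rest (fun ω => (X i ω, R i ω)) P := by
    have h0 := h.indep.indepFun_finset T {(i : ℕ)} (by simp [hT]) hpair
    refine h0.comp (φ := fun (e : T → Covariate d × ℝ) (j : Fin n) =>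
      if hj : (j : ℕ) ∈ T then (e ⟨j, hj⟩).1 else 0)
      (ψ := fun e : ({(i : ℕ)} : Finset ℕ) → Covariate d × ℝ => e ⟨i, by simp⟩) ?_ ?_
    · refine measurable_pi_lambda _ fun j => ?_
      by_cases hj : (j : ℕ) ∈ T
      · simp only [dif_pos hj]
        exact measurable_fst.comp (measurable_pi_apply _)
      · simp only [dif_neg hj, measurable_const]
    · exact measurable_pi_apply _
  have hdesign : ∀ ω, design X n ω = Function.update (rest ω) i (X i ω) := fun ω => by
    funext j
    by_cases hj : j = i
    · subst hj; simp [design]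
    · have : (j : ℕ) ∈ T := by simp [hT, Fin.val_ne_iff.2 hj]
      simp [hrest, design, Function.update_of_ne hj, this]
  set G : (Fin n → Covariate d) × (Covariate d × ℝ) → ℝ := fun q =>
    a (Function.update q.1 i q.2.1) * q.2.2 with hG
  have hupd : Measurable fun q : (Fin n → Covariate d) × (Covariate d × ℝ) =>
      Function.update q.1 i q.2.1 := by
    refine measurable_pi_lambda _ fun j => ?_
    by_cases hj : j = i
    · subst hj; simp only [Function.update_self]; fun_prop
    · simp only [Function.update_of_ne hj]; fun_prop
  have hGm : Measurable G := (ha.comp hupd).mul (measurable_snd.comp measurable_snd)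
  have hGeq : ∀ ω, a (design X n ω) * R i ω = G (rest ω, (X i ω, R i ω)) := fun ω => by
    rw [hdesign]
  simp only [hGeq] at hint ⊢
  have hjoint := (indepFun_iff_map_prod_eq_prod_map_map hrm.aemeasurable
    (hpair i).aemeasurable).1 hind
  rw [(h.ident i).map_eq] at hjoint
  have hjm := hrm.prodMk (hpair i)
  have := Measure.isProbabilityMeasure_map (μ := P) hrm.aemeasurable
  have := Measure.isProbabilityMeasure_map (μ := P) (hpair 0).aemeasurable
  have hintG : Integrable G ((P.map rest).prod (P.map fun ω => (X 0 ω, R 0 ω))) := by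
    rw [← hjoint]
    exact (integrable_map_measure hGm.aestronglyMeasurable hjm.aemeasurable).2 hint
  have hint_eq : ∫ ω, G (rest ω, (X i ω, R i ω)) ∂P =
      ∫ q, G q ∂((P.map rest).prod (P.map fun ω => (X 0 ω, R 0 ω))) := by
    rw [← hjoint, integral_map hjm.aemeasurable hGm.aestronglyMeasurable]
  rw [hint_eq, integral_prod _ hintG]
  refine integral_eq_zero_of_ae ?_
  filter_upwards [hintG.prod_right_ae] with w hw
  have hGw : Measurable fun y => G (w, y) := hGm.comp measurable_prodMk_left
  rw [integral_map (hpair 0).aemeasurable hGw.aestronglyMeasurable]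
  refine h.integral_mul_eq_zero (g := fun x => a (Function.update w i x))
    (ha.comp (measurable_update w)) ?_
  exact (integrable_map_measure hGw.aestronglyMeasurable (hpair 0).aemeasurable).1 hw

end CenteredErrors

end Errors

/-! ### Finite-sample unbiasedness -/

namespace CenteredErrors

variable {Ω : Type*} [MeasurableSpace Ω] {P : Measure Ω} {d p : ℕ}
  {φ : Fin p → Covariate d → ℝ} {X : ℕ → Ω → Covariate d} {R : ℕ → Ω → ℝ}
  {b : Fin p → ℝ} {z : ℕ → Ω → ℝ} {M : ℝ}

theorem measurable_design (h : CenteredErrors P X R) (n : ℕ) : Measurable (design X n) :=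
  measurable_pi_lambda _ fun i => h.measurable_X i

theorem ae_abs_basis_le (h : CenteredErrors P X R) (hφ : ∀ j, Measurable (φ j))
    (hM : ∀ j, ∀ᵐ ω ∂P, |φ j (X 0 ω)| ≤ M) : ∀ᵐ ω ∂P, ∀ j i, |φ j (X i ω)| ≤ M := by
  refine ae_all_iff.2 fun j => ae_all_iff.2 fun i => ?_
  exact (h.identDistrib_X i).symm.ae_mem_snd (t := {x | |φ j x| ≤ M})
    (measurableSet_le (hφ j).abs measurable_const) (hM j)

variable [IsProbabilityMeasure P]

theorem memLp_basis (h : CenteredErrors P X R) (hφ : ∀ j, Measurable (φ j))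
    (hM : ∀ j, ∀ᵐ ω ∂P, |φ j (X 0 ω)| ≤ M) (q : ENNReal) (j : Fin p) (i : ℕ) :
    MemLp (fun ω => φ j (X i ω)) q P := by
  refine MemLp.of_bound ((hφ j).comp (h.measurable_X i)).aestronglyMeasurable M ?_
  filter_upwards [h.ae_abs_basis_le hφ hM] with ω hω
  exact hω j i

theorem integrableOn_ols (h : CenteredErrors P X R) (hφ : ∀ j, Measurable (φ j))
    (hM : ∀ j, ∀ᵐ ω ∂P, |φ j (X 0 ω)| ≤ M)
    (hz : ∀ i, z i =ᵐ[P] fun ω => ∑ j, φ j (X i ω) * b j + R i ω) (n : ℕ) {δ : ℝ} (hδ : 0 < δ)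
    (j : Fin p) :
    IntegrableOn (fun ω => ols φ (design X n ω) (fun i => z i ω) j)
      {ω | δ ≤ (gram φ (design X n ω)).det} P := by
  obtain ⟨c, hc⟩ := exists_olsWeight_bound (n := n) (φ := φ) (M := M) hδ
  have hzint : ∀ i, Integrable (z i) P := fun i => by
    refine Integrable.congr ?_ (hz i).symm
    refine (integrable_finsetSum _ fun j _ => ?_).add (h.integrable_R i)
    exact ((h.memLp_basis hφ hM 1 j i).integrable le_rfl).mul_const _
  have hE : MeasurableSet {ω | δ ≤ (gram φ (design X n ω)).det} :=
    measurableSet_le measurable_const ((measurable_det_gram hφ).comp (h.measurable_design n))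
  simp only [ols_eq_olsWeight_mulVec, Matrix.mulVec, dotProduct]
  refine integrable_finsetSum _ fun i _ => ?_
  refine (hzint i).integrableOn.bdd_mul (c := c)
    ((measurable_olsWeight hφ j i).comp (h.measurable_design n)).aestronglyMeasurable ?_
  filter_upwards [ae_restrict_mem hE, ae_restrict_of_ae (h.ae_abs_basis_le hφ hM)] with ω h1 h2
  exact hc _ (fun j i => h2 j i) h1 j i

/-- Bounded weights make each product of a weight and an error integrable, so the error of the
estimator can be integrated term by term, and every term vanishes. -/
theorem setIntegral_ols_of_olsWeight_le (h : CenteredErrors P X R) (hφ : ∀ j, Measurable (φ j))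
    (hz : ∀ i, z i =ᵐ[P] fun ω => ∑ j, φ j (X i ω) * b j + R i ω) {n : ℕ}
    {S : Set (Fin n → Covariate d)} (hS : MeasurableSet S) (hdet : ∀ x ∈ S, (gram φ x).det ≠ 0)
    {j : Fin p} {c : ℝ} (hc : ∀ x ∈ S, ∀ i, |olsWeight φ x j i| ≤ c) :
    ∫ ω in {ω | design X n ω ∈ S}, ols φ (design X n ω) (fun i => z i ω) j ∂P =
      P.real {ω | design X n ω ∈ S} * b j := by
  have hD := h.measurable_design n
  have hSm : MeasurableSet {ω | design X n ω ∈ S} := hD hS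
  have hwm : ∀ i, Measurable (S.indicator fun x => olsWeight φ x j i) := fun i =>
    (measurable_olsWeight hφ j i).indicator hS
  have hint : ∀ i : Fin n, Integrable (fun ω =>
      S.indicator (fun x => olsWeight φ x j i) (design X n ω) * R i ω) P := fun i => by
    -- The bound is `|c|` because `c` may be negative when its hypothesis is vacuous, while the
    -- indicator is zero off `S`.
    refine (h.integrable_R i).bdd_mul (c := |c|) ((hwm i).comp hD).aestronglyMeasurable
      (.of_forall fun ω => ?_)
    by_cases hω : design X n ω ∈ S
    · simpa [Set.indicator_of_mem hω] using (hc _ hω i).trans (le_abs_self c)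
    · simp [Set.indicator_of_notMem hω]
  rw [← integral_indicator hSm]
  have hae : (({ω | design X n ω ∈ S}.indicator fun ω =>
      ols φ (design X n ω) (fun i => z i ω) j)) =ᵐ[P] fun ω =>
      {ω | design X n ω ∈ S}.indicator (fun _ => b j) ω + ∑ i : Fin n,
        S.indicator (fun x => olsWeight φ x j i) (design X n ω) * R i ω := by
    filter_upwards [ae_all_iff.2 hz] with ω hω
    by_cases hmem : design X n ω ∈ S
    · have hmem' : ω ∈ {ω | design X n ω ∈ S} := hmem
      rw [Set.indicator_of_mem hmem', Set.indicator_of_mem hmem']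
      simp only [Set.indicator_of_mem hmem]
      have : (fun i : Fin n => z i ω) =
          fun i : Fin n => ∑ j, φ j (design X n ω i) * b j + R i ω := funext fun i => hω i
      rw [this, ols_linear_add (hdet _ hmem), ols_eq_olsWeight_mulVec]
      rfl
    · have hmem' : ω ∉ {ω | design X n ω ∈ S} := hmem
      rw [Set.indicator_of_notMem hmem', Set.indicator_of_notMem hmem']
      simp [Set.indicator_of_notMem hmem]
  rw [integral_congr_ae hae, integral_add ((integrable_const _).indicator hSm)
    (integrable_finsetSum _ fun i _ => hint i), integral_finsetSum _ fun i _ => hint i,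
    Finset.sum_eq_zero fun i _ => h.integral_design_mul_eq_zero i (hwm i) (hint i), add_zero,
    integral_indicator hSm, setIntegral_const, smul_eq_mul]

/-- Integrability of the estimator does not give integrability of the separate terms, so the sum
cannot be split directly. The designs in `S` with weights at most `m` increase to `S`; the identity
holds on each, and both sides converge. -/
theorem setIntegral_ols (h : CenteredErrors P X R) (hφ : ∀ j, Measurable (φ j))
    (hz : ∀ i, z i =ᵐ[P] fun ω => ∑ j, φ j (X i ω) * b j + R i ω) {n : ℕ}
    {S : Set (Fin n → Covariate d)} (hS : MeasurableSet S) (hdet : ∀ x ∈ S, (gram φ x).det ≠ 0)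
    {j : Fin p} (hint : IntegrableOn (fun ω => ols φ (design X n ω) (fun i => z i ω) j)
      {ω | design X n ω ∈ S} P) :
    ∫ ω in {ω | design X n ω ∈ S}, ols φ (design X n ω) (fun i => z i ω) j ∂P =
      P.real {ω | design X n ω ∈ S} * b j := by
  have hD := h.measurable_design n
  set A : ℕ → Set (Fin n → Covariate d) := fun m => S ∩ {x | ∀ i, |olsWeight φ x j i| ≤ m} with hA
  have hAm : ∀ m, MeasurableSet (A m) := fun m => by
    refine hS.inter ?_
    rw [Set.ofPred_forall]
    exact MeasurableSet.iInter fun i =>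
      measurableSet_le (measurable_olsWeight hφ j i).abs measurable_const
  have hmono : Monotone fun m => {ω | design X n ω ∈ A m} := fun m m' hm ω hω =>
    ⟨hω.1, fun i => (hω.2 i).trans (by exact_mod_cast hm)⟩
  have hunion : ⋃ m, {ω | design X n ω ∈ A m} = {ω | design X n ω ∈ S} := by
    ext ω
    simp only [Set.mem_iUnion, Set.mem_ofPred_eq]
    refine ⟨fun ⟨m, hm⟩ => hm.1, fun hω => ?_⟩
    obtain ⟨m, hm⟩ := exists_nat_ge (∑ i, |olsWeight φ (design X n ω) j i|)
    exact ⟨m, hω, fun i => (Finset.single_le_sum (fun i _ => abs_nonneg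
      (olsWeight φ (design X n ω) j i)) (Finset.mem_univ i)).trans hm⟩
  have hlim := tendsto_setIntegral_of_monotone (μ := P) (s := fun m => {ω | design X n ω ∈ A m})
    (fun m => hD (hAm m)) hmono (by rwa [hunion])
  have hlim' : Tendsto (fun m => P.real {ω | design X n ω ∈ A m} * b j) atTop
      (𝓝 (P.real {ω | design X n ω ∈ S} * b j)) := by
    refine Tendsto.mul_const _ ?_
    rw [← hunion]
    exact (ENNReal.tendsto_toReal (measure_ne_top _ _)).comp (tendsto_measure_iUnion_atTop hmono)
  rw [hunion] at hlim
  refine tendsto_nhds_unique hlim (hlim'.congr fun m => ?_)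
  exact (h.setIntegral_ols_of_olsWeight_le hφ hz (hAm m) (fun x hx => hdet x hx.1)
    (fun x hx => hx.2)).symm

theorem unbiased_ols (h : CenteredErrors P X R) (hφ : ∀ j, Measurable (φ j))
    (hM : ∀ j, ∀ᵐ ω ∂P, |φ j (X 0 ω)| ≤ M)
    (hz : ∀ i, z i =ᵐ[P] fun ω => ∑ j, φ j (X i ω) * b j + R i ω) :
    Unbiased P φ X (fun n ω => ols φ (design X n ω) (fun i => z i ω)) b where
  integrableOn n _ hδ j := h.integrableOn_ols hφ hM hz n hδ j
  conditional _ _ hS hdet _ hint := h.setIntegral_ols hφ hz hS hdet hint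
  mean n hdet j hint := by
    have hS : MeasurableSet {x : Fin n → Covariate d | (gram φ x).det ≠ 0} :=
      (measurable_det_gram hφ) (measurableSet_singleton 0).compl
    have huniv : {ω | design X n ω ∈ {x : Fin n → Covariate d | (gram φ x).det ≠ 0}} =ᵐ[P]
        Set.univ := by
      rw [ae_eq_univ]
      exact hdet
    have := h.setIntegral_ols hφ hz hS (fun x hx => hx) (j := j) hint.integrableOn
    rwa [setIntegral_congr_set huniv, setIntegral_univ, measureReal_congr huniv,
      probReal_univ, one_mul] at this

end CenteredErrors

/-! ### Asymptotic normality -/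

namespace CenteredErrors

variable {Ω : Type*} [MeasurableSpace Ω] {P : Measure Ω} {d p : ℕ}
  {φ : Fin p → Covariate d → ℝ} {X : ℕ → Ω → Covariate d} {R : ℕ → Ω → ℝ}
  {b : Fin p → ℝ} {z : ℕ → Ω → ℝ} {M : ℝ}

/-- The influence function `F⁻¹ φ(X) R` of the least squares estimator. -/
noncomputable def influence (F : Matrix (Fin p) (Fin p) ℝ) (φ : Fin p → Covariate d → ℝ)
    (x : Covariate d) (r : ℝ) : Fin p → ℝ :=
  fun j => F⁻¹.mulVec (fun l => φ l x) j * r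

theorem measurable_influence (F : Matrix (Fin p) (Fin p) ℝ) (hφ : ∀ j, Measurable (φ j)) :
    Measurable fun q : Covariate d × ℝ => influence F φ q.1 q.2 := by
  refine measurable_pi_lambda _ fun j => Measurable.mul ?_ measurable_snd
  simp only [Matrix.mulVec, dotProduct]
  exact Finset.measurable_fun_sum _ fun l _ => ((hφ l).comp measurable_fst).const_mul _

variable [IsProbabilityMeasure P]

theorem memLp_influence (h : CenteredErrors P X R) (hφ : ∀ j, Measurable (φ j))
    (hM : ∀ j, ∀ᵐ ω ∂P, |φ j (X 0 ω)| ≤ M) (F : Matrix (Fin p) (Fin p) ℝ) (j : Fin p) :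
    MemLp (fun ω => influence F φ (X 0 ω) (R 0 ω) j) 2 P := by
  have h1 : MemLp (fun ω => F⁻¹.mulVec (fun l => φ l (X 0 ω)) j) ⊤ P := by
    simp only [Matrix.mulVec, dotProduct]
    exact memLp_finsetSum _ fun l _ => (h.memLp_basis hφ hM ⊤ l 0).const_mul _
  exact h.memLp.mul h1

theorem integral_influence (h : CenteredErrors P X R) (hφ : ∀ j, Measurable (φ j))
    (hM : ∀ j, ∀ᵐ ω ∂P, |φ j (X 0 ω)| ≤ M) (F : Matrix (Fin p) (Fin p) ℝ) (j : Fin p) :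
    ∫ ω, influence F φ (X 0 ω) (R 0 ω) j ∂P = 0 :=
  h.integral_mul_eq_zero (g := fun x => F⁻¹.mulVec (fun l => φ l x) j)
    (by
      simp only [Matrix.mulVec, dotProduct]
      exact Finset.measurable_fun_sum _ fun l _ => (hφ l).const_mul _)
    ((h.memLp_influence hφ hM F j).integrable (by norm_num))

theorem ae_tendsto_gram (h : CenteredErrors P X R) (hφ : ∀ j, Measurable (φ j))
    (hM : ∀ j, ∀ᵐ ω ∂P, |φ j (X 0 ω)| ≤ M) :
    ∀ᵐ ω ∂P, Tendsto (fun n : ℕ => (n : ℝ)⁻¹ • gram φ (design X n ω)) atTop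
      (𝓝 (secondMoment P φ X)) := by
  have key : ∀ j j', ∀ᵐ ω ∂P, Tendsto (fun n : ℕ => (n : ℝ)⁻¹ * gram φ (design X n ω) j j') atTop
      (𝓝 (secondMoment P φ X j j')) := fun j j' => by
    have hm : Measurable fun q : Covariate d × ℝ => φ j q.1 * φ j' q.1 :=
      ((hφ j).comp measurable_fst).mul ((hφ j').comp measurable_fst)
    have hslln := strong_law_ae_real (μ := P) (fun i ω => φ j (X i ω) * φ j' (X i ω))
      ((h.memLp_basis hφ hM 2 j 0).integrable_mul (h.memLp_basis hφ hM 2 j' 0))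
      (fun i i' hi => (h.indep.indepFun hi).comp hm hm) (fun i => (h.ident i).comp hm)
    filter_upwards [hslln] with ω hω
    refine hω.congr fun n => ?_
    rw [gram_apply, Finset.sum_range, div_eq_inv_mul]
    rfl
  filter_upwards [ae_all_iff.2 fun j => ae_all_iff.2 (key j)] with ω hω
  exact tendsto_pi_nhds.2 fun j => tendsto_pi_nhds.2 fun j' => hω j j'

/-- Inserting `F F⁻¹` separates a random matrix that will tend to the identity from a normalized sum
of i.i.d. vectors. -/
theorem sqrt_mul_ols_sub {n : ℕ} (hn : n ≠ 0) {F : Matrix (Fin p) (Fin p) ℝ} (hF : IsUnit F.det)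
    {x : Fin n → Covariate d} (hx : (gram φ x).det ≠ 0) (b : Fin p → ℝ) (r : Fin n → ℝ)
    (i : Fin p) :
    √(n : ℝ) * (ols φ x (fun i => ∑ j, φ j (x i) * b j + r i) i - b i) =
      ∑ j, (((n : ℝ)⁻¹ • gram φ x)⁻¹ * F) i j *
        ((√(n : ℝ))⁻¹ * ∑ k, influence F φ (x k) (r k) j) := by
  have hn' : (n : ℝ) ≠ 0 := by exact_mod_cast hn
  have hs : √(n : ℝ) * √(n : ℝ) = n := Real.mul_self_sqrt n.cast_nonneg
  have hs0 : √(n : ℝ) ≠ 0 := fun h0 => hn' (by rw [← hs, h0, zero_mul])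
  have hinfl : (fun j => (√(n : ℝ))⁻¹ * ∑ k, influence F φ (x k) (r k) j) =
      (√(n : ℝ))⁻¹ • F⁻¹.mulVec ((regressionMatrix φ x).transpose.mulVec r) := by
    funext j
    simp only [Pi.smul_apply, smul_eq_mul, influence, Matrix.mulVec, dotProduct,
      Matrix.transpose_apply, regressionMatrix, Matrix.of_apply, Finset.mul_sum, Finset.sum_mul]
    rw [Finset.sum_comm]
    exact Finset.sum_congr rfl fun l _ => Finset.sum_congr rfl fun k _ => by ring
  have hinv : ((n : ℝ)⁻¹ • gram φ x)⁻¹ = (n : ℝ) • (gram φ x)⁻¹ := by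
    have := Matrix.inv_smul' (A := gram φ x) (Units.mk0 (n : ℝ)⁻¹ (inv_ne_zero hn'))
      (isUnit_iff_ne_zero.2 hx)
    simpa [Units.smul_def] using this
  rw [ols_linear_add hx, Pi.add_apply, add_sub_cancel_left]
  change _ = (((n : ℝ)⁻¹ • gram φ x)⁻¹ * F).mulVec
    (fun j => (√(n : ℝ))⁻¹ * ∑ k, influence F φ (x k) (r k) j) i
  rw [hinfl, hinv, Matrix.mulVec_smul, Matrix.mulVec_mulVec, Matrix.mul_assoc,
    Matrix.mul_nonsing_inv _ hF, Matrix.mul_one, Matrix.smul_mulVec, smul_smul, ols,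
    Pi.smul_apply, smul_eq_mul]
  congr 1
  rw [eq_inv_mul_iff_mul_eq₀ hs0, hs]

theorem hasAsymptoticCovariance_ols (h : CenteredErrors P X R) (hφ : ∀ j, Measurable (φ j))
    (hM : ∀ j, ∀ᵐ ω ∂P, |φ j (X 0 ω)| ≤ M) (hF : IsUnit (secondMoment P φ X).det)
    (hz : ∀ i, z i =ᵐ[P] fun ω => ∑ j, φ j (X i ω) * b j + R i ω) :
    HasAsymptoticCovariance P (fun n ω => ols φ (design X n ω) (fun i => z i ω)) b
      (momentMatrix P fun ω => influence (secondMoment P φ X) φ (X 0 ω) (R 0 ω)) := by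
  set F := secondMoment P φ X with hFdef
  have hinfl := measurable_influence F hφ
  have hclt := tendstoInDistribution_multivariateGaussian
    (V := fun k ω => influence F φ (X k ω) (R k ω))
    (h.indep.comp (fun _ q => influence F φ q.1 q.2) fun _ => hinfl)
    (fun k => (h.ident k).comp hinfl)
    (h.memLp_influence hφ hM F) (h.integral_influence hφ hM F)
  refine ⟨posSemidef_momentMatrix (h.memLp_influence hφ hM F), ?_⟩
  set Q : ℕ → Ω → Fin p → Fin p → ℝ := fun n ω =>
    ((n : ℝ)⁻¹ • gram φ (design X n ω))⁻¹ * F with hQ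
  have hQm : ∀ n, Measurable (Q n) := fun n => by
    refine measurable_pi_lambda _ fun i => measurable_pi_lambda _ fun j => ?_
    simp only [hQ, Matrix.mul_apply]
    refine Finset.measurable_fun_sum _ fun l _ => Measurable.mul_const ?_ _
    refine measurable_inv_apply ?_ i l
    refine measurable_pi_lambda _ fun i => measurable_pi_lambda _ fun j => ?_
    simp only [Matrix.smul_apply, smul_eq_mul]
    exact ((measurable_pi_apply j).comp ((measurable_pi_apply i).comp
      ((measurable_gram hφ).comp (h.measurable_design n)))).const_mul _
  have hQlim : ∀ᵐ ω ∂P, Tendsto (fun n => Q n ω) atTop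
      (𝓝 ((1 : Matrix (Fin p) (Fin p) ℝ) : Fin p → Fin p → ℝ)) := by
    filter_upwards [h.ae_tendsto_gram hφ hM] with ω hω
    have hcont : ContinuousAt (fun A : Matrix (Fin p) (Fin p) ℝ => A⁻¹) F :=
      continuousAt_matrix_inv _ (by
        rw [Ring.inverse_eq_inv']
        exact continuousAt_inv₀ hF.ne_zero)
    have := (hcont.tendsto.comp hω).mul_const F
    rwa [Matrix.nonsing_inv_mul _ hF] at this
  -- Slutsky's theorem for the continuous map `(v, Q) ↦ Q v`, which is the identity in `v` at the
  -- limit `Q = 1`.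
  have hslutsky := hclt.continuous_comp_prodMk_of_tendstoInMeasure_const
    (g := fun q : EuclideanSpace ℝ (Fin p) × (Fin p → Fin p → ℝ) =>
      (WithLp.toLp 2 fun i => ∑ j, q.2 i j * q.1 j : EuclideanSpace ℝ (Fin p)))
    (by fun_prop)
    (tendstoInMeasure_of_tendsto_ae (fun n => (hQm n).aestronglyMeasurable) hQlim)
    (fun n => (hQm n).aemeasurable)
  have hid : (fun v : EuclideanSpace ℝ (Fin p) => (WithLp.toLp 2 fun i =>
      ∑ j, (1 : Matrix (Fin p) (Fin p) ℝ) i j * v j : EuclideanSpace ℝ (Fin p))) = id := by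
    funext v
    ext i
    exact congrFun (Matrix.one_mulVec v.ofLp) i
  simp only [id_eq] at hslutsky
  rw [hid] at hslutsky
  have hzm : ∀ i, AEMeasurable (z i) P := fun i => by
    refine AEMeasurable.congr (Measurable.aemeasurable ?_) (hz i).symm
    exact (Finset.measurable_fun_sum _ fun j _ =>
      ((hφ j).comp (h.measurable_X i)).mul_const _).add (h.measurable_R i)
  have hTm : ∀ n : ℕ, AEMeasurable (fun ω => (WithLp.toLp 2 fun j => √(n : ℝ) *
      (ols φ (design X n ω) (fun i => z i ω) j - b j) : EuclideanSpace ℝ (Fin p))) P := fun n => by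
    refine (WithLp.measurable_toLp 2 (Fin p → ℝ)).comp_aemeasurable
      (aemeasurable_pi_lambda _ fun j => AEMeasurable.const_mul (AEMeasurable.sub_const ?_ _) _)
    simp only [ols_eq_olsWeight_mulVec, Matrix.mulVec, dotProduct]
    exact Finset.aemeasurable_fun_sum _ fun i _ => ((measurable_olsWeight hφ j i).comp
      (h.measurable_design n)).aemeasurable.mul (hzm i)
  -- The factorization needs an invertible Gram matrix, which may fail for some `n`. Almost surely
  -- `det (HᵀH/n)` tends to `det F ≠ 0`, so the difference of the two sequences is eventually zero.
  refine tendstoInDistribution_of_tendstoInMeasure_sub _ _ hslutsky ?_ hTm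
  refine tendstoInMeasure_of_tendsto_ae
    (fun n => ((hTm n).sub (hslutsky.forall_aemeasurable n)).aestronglyMeasurable) ?_
  filter_upwards [h.ae_tendsto_gram hφ hM, ae_all_iff.2 hz] with ω hω hzω
  refine tendsto_const_nhds.congr' ?_
  have hdet : Tendsto (fun n : ℕ => ((n : ℝ)⁻¹ • gram φ (design X n ω)).det) atTop
      (𝓝 F.det) := (continuous_id.matrix_det.tendsto F).comp hω
  filter_upwards [hdet.eventually_ne hF.ne_zero, eventually_ne_atTop 0] with n hn hn0
  have hg : (gram φ (design X n ω)).det ≠ 0 := fun h0 =>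
      hn (by rw [Matrix.det_smul, h0, mul_zero])
  have hzeq : (fun i : Fin n => z i ω) =
      fun i : Fin n => ∑ j, φ j (design X n ω i) * b j + R i ω := funext fun i => hzω i
  symm
  rw [Pi.sub_apply, Pi.sub_apply, Pi.zero_apply, sub_eq_zero]
  ext i
  simp only [hzeq]
  rw [sqrt_mul_ols_sub hn0 hF hg b (fun i : Fin n => R i ω) i]
  refine Finset.sum_congr rfl fun j _ => ?_
  simp only [Finset.sum_range]
  rfl

end CenteredErrors

/-! ### Moments and conditional expectations under the treatment model -/

theorem ind_self {K : ℕ} (t : Fin (K + 1)) : ind t t = 1 := if_pos rfl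

theorem ind_of_ne {K : ℕ} {s t : Fin (K + 1)} (h : s ≠ t) : ind s t = 0 := if_neg h

theorem sum_ind_mul {K : ℕ} (s : Fin (K + 1)) (g : Fin (K + 1) → ℝ) : ∑ t, ind s t * g t = g s := by
  simp [ind]

theorem abs_ind_le_one {K : ℕ} (s t : Fin (K + 1)) : |ind s t| ≤ 1 := by
  rw [ind]; split_ifs <;> simp

theorem measurable_ind {K : ℕ} (t : Fin (K + 1)) : Measurable fun s => ind s t :=
  measurable_of_finite _

namespace LinearModel

variable {Ω : Type*} [MeasurableSpace Ω] {P : Measure Ω} {d K p : ℕ}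
  {D : Set (Covariate d)} {X : ℕ → Ω → Covariate d} {T : ℕ → Ω → Fin (K + 1)}
  {noise : ℕ → Fin (K + 1) → Ω → ℝ} {σ : ℝ≥0} {r : Fin (K + 1) → Covariate d → ℝ} {rmin : ℝ}
  {f : Fin (K + 1) → Covariate d → ℝ} {φ : Fin p → Covariate d → ℝ} {β : Fin (K + 1) → Fin p → ℝ}
  {c : Covariate d → Fin (K + 1) → ℝ}

theorem measurable_covariate_treatment (h : LinearModel P D X T noise σ r rmin f φ β)
    (hc : ∀ t, Measurable fun x => c x t) (i : ℕ) : Measurable fun ω => c (X i ω) (T i ω) :=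
  (measurable_from_prod_countable_left
    (f := fun q : Covariate d × Fin (K + 1) => c q.1 q.2) hc).comp
    ((h.measurable_X i).prodMk (h.measurable_T i))

theorem memLp_ind_mul (h : LinearModel P D X T noise σ r rmin f φ β) {s : ENNReal}
    {g : Ω → ℝ} (hg : MemLp g s P) (t : Fin (K + 1)) :
    MemLp (fun ω => ind (T 0 ω) t * g ω) s P := by
  refine hg.of_le_mul (c := 1) ((((measurable_ind t).comp
    (h.measurable_T 0)).aestronglyMeasurable).mul hg.1) (.of_forall fun ω => ?_)
  rw [norm_mul]
  exact mul_le_mul_of_nonneg_right (abs_ind_le_one _ _) (norm_nonneg _)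

theorem integrable_ind_mul (h : LinearModel P D X T noise σ r rmin f φ β)
    {g : Ω → ℝ} (hg : Integrable g P) (t : Fin (K + 1)) :
    Integrable (fun ω => ind (T 0 ω) t * g ω) P :=
  memLp_one_iff_integrable.1 (h.memLp_ind_mul (memLp_one_iff_integrable.2 hg) t)

theorem memLp_covariate_treatment (h : LinearModel P D X T noise σ r rmin f φ β) {s : ENNReal}
    (hc : ∀ t, MemLp (fun ω => c (X 0 ω) t) s P) : MemLp (fun ω => c (X 0 ω) (T 0 ω)) s P := by
  simp_rw [← sum_ind_mul (T 0 _) (c (X 0 _))]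
  exact memLp_finsetSum _ fun t _ => h.memLp_ind_mul (hc t) t

theorem integrable_covariate_treatment (h : LinearModel P D X T noise σ r rmin f φ β)
    (hc : ∀ t, Integrable (fun ω => c (X 0 ω) t) P) :
    Integrable (fun ω => c (X 0 ω) (T 0 ω)) P :=
  memLp_one_iff_integrable.1
    (h.memLp_covariate_treatment fun t => memLp_one_iff_integrable.2 (hc t))

/-- The noise is selected by `T`, so independence is used one level at a time: on `T = t` the factor
is a function of `(X, T)` times `q (ε(t))`. All levels share one noise law, so the second factor
comes out of the sum. -/
theorem integrable_and_integral_mul_noise (h : LinearModel P D X T noise σ r rmin f φ β)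
    (hc : ∀ t, Measurable fun x => c x t) (hci : ∀ t, Integrable (fun ω => c (X 0 ω) t) P)
    {q : ℝ → ℝ} (hq : Measurable q) (hqi : Integrable q (gaussianReal 0 (σ ^ 2))) :
    Integrable (fun ω => c (X 0 ω) (T 0 ω) * q (noise 0 (T 0 ω) ω)) P ∧
      ∫ ω, c (X 0 ω) (T 0 ω) * q (noise 0 (T 0 ω) ω) ∂P =
        (∫ ω, c (X 0 ω) (T 0 ω) ∂P) * ∫ e, q e ∂(gaussianReal 0 (σ ^ 2)) := by
  have hui : ∀ t, Integrable (fun ω => ind (T 0 ω) t * c (X 0 ω) t) P := fun t =>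
    h.integrable_ind_mul (hci t) t
  have hq0 : ∀ t, Integrable (fun ω => q (noise 0 t ω)) P := fun t => by
    rw [← (h.noise_law t).map_eq] at hqi
    exact (integrable_map_measure hq.aestronglyMeasurable
      (h.measurable_noise 0 t).aemeasurable).1 hqi
  have hqint : ∀ t, ∫ ω, q (noise 0 t ω) ∂P = ∫ e, q e ∂(gaussianReal 0 (σ ^ 2)) := fun t => by
    rw [← (h.noise_law t).map_eq, integral_map (h.measurable_noise 0 t).aemeasurable
      hq.aestronglyMeasurable]
  have hind : ∀ t, IndepFun (fun ω => ind (T 0 ω) t * c (X 0 ω) t)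
      (fun ω => q (noise 0 t ω)) P := fun t =>
    h.noise_indep_XT.comp (φ := fun y : Covariate d × Fin (K + 1) => ind y.2 t * c y.1 t)
      (ψ := fun e : Fin (K + 1) → ℝ => q (e t)) (((measurable_ind t).comp measurable_snd).mul
        ((hc t).comp measurable_fst)) (hq.comp (measurable_pi_apply t))
  have hprod : ∀ t, Integrable (fun ω => ind (T 0 ω) t * c (X 0 ω) t * q (noise 0 t ω)) P :=
    fun t => (hind t).integrable_mul (hui t) (hq0 t)
  have hdecomp : ∀ ω, c (X 0 ω) (T 0 ω) * q (noise 0 (T 0 ω) ω) =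
      ∑ t, ind (T 0 ω) t * c (X 0 ω) t * q (noise 0 t ω) := fun ω => by
    simp_rw [mul_assoc]
    exact (sum_ind_mul (T 0 ω) fun t => c (X 0 ω) t * q (noise 0 t ω)).symm
  simp_rw [hdecomp]
  refine ⟨integrable_finsetSum _ fun t _ => hprod t, ?_⟩
  simp_rw [← sum_ind_mul (T 0 _) (c (X 0 _))]
  rw [integral_finsetSum _ fun t _ => hprod t, integral_finsetSum _ fun t _ => hui t,
    Finset.sum_mul]
  refine Finset.sum_congr rfl fun t _ => ?_
  rw [(hind t).integral_fun_mul_eq_mul_integral (hui t).1 (hq0 t).1, hqint]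

theorem integral_mul_noise (h : LinearModel P D X T noise σ r rmin f φ β)
    (hc : ∀ t, Measurable fun x => c x t) (hci : ∀ t, Integrable (fun ω => c (X 0 ω) t) P) :
    Integrable (fun ω => c (X 0 ω) (T 0 ω) * noise 0 (T 0 ω) ω) P ∧
      ∫ ω, c (X 0 ω) (T 0 ω) * noise 0 (T 0 ω) ω ∂P = 0 := by
  have := h.integrable_and_integral_mul_noise hc hci (q := fun e => e) measurable_id
    ((memLp_id_gaussianReal 1).integrable le_rfl)
  refine ⟨this.1, ?_⟩
  rw [this.2, integral_id_gaussianReal, mul_zero]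

theorem integral_mul_noise_sq (h : LinearModel P D X T noise σ r rmin f φ β)
    (hc : ∀ t, Measurable fun x => c x t) (hci : ∀ t, Integrable (fun ω => c (X 0 ω) t) P) :
    Integrable (fun ω => c (X 0 ω) (T 0 ω) * noise 0 (T 0 ω) ω ^ 2) P ∧
      ∫ ω, c (X 0 ω) (T 0 ω) * noise 0 (T 0 ω) ω ^ 2 ∂P =
        (σ : ℝ) ^ 2 * ∫ ω, c (X 0 ω) (T 0 ω) ∂P := by
  have := h.integrable_and_integral_mul_noise hc hci (q := fun e => e ^ 2)
    (measurable_id.pow_const 2) (memLp_id_gaussianReal 2).integrable_sq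
  refine ⟨this.1, ?_⟩
  have hv := variance_id_gaussianReal (μ := 0) (v := σ ^ 2)
  rw [variance_of_integral_eq_zero measurable_id.aemeasurable integral_id_gaussianReal] at hv
  simp only [id_eq] at hv
  rw [this.2, hv, mul_comm]
  norm_cast

variable [IsProbabilityMeasure P]

/-- The upper bound holds because `r t (X)` is the conditional expectation of an indicator. -/
theorem ae_mem_Icc_gps (h : LinearModel P D X T noise σ r rmin f φ β) (t : Fin (K + 1)) :
    ∀ᵐ ω ∂P, rmin ≤ r t (X 0 ω) ∧ r t (X 0 ω) ≤ 1 := by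
  have hle := (h.measurable_X 0).comap_le
  have hset : MeasurableSet {ω | T 0 ω = t} := h.measurable_T 0 (measurableSet_singleton t)
  have hmono : P[Set.indicator {ω | T 0 ω = t} (fun _ => (1 : ℝ)) |
      MeasurableSpace.comap (X 0) inferInstance] ≤ᵐ[P]
      P[fun _ => (1 : ℝ) | MeasurableSpace.comap (X 0) inferInstance] :=
    condExp_mono ((integrable_const _).indicator hset) (integrable_const _)
      (.of_forall fun ω => Set.indicator_le_self' (fun _ _ => zero_le_one) ω)
  rw [condExp_const hle] at hmono
  filter_upwards [hmono, h.gps t, h.mem_D 0] with ω h1 h2 h3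
  exact ⟨h.overlap t _ h3, h2 ▸ h1⟩

theorem rmin_le_one (h : LinearModel P D X T noise σ r rmin f φ β) : rmin ≤ 1 := by
  obtain ⟨ω, hω⟩ := (h.ae_mem_Icc_gps 0).exists
  exact hω.1.trans hω.2

theorem integrable_gps_mul (h : LinearModel P D X T noise σ r rmin f φ β) {g : Ω → ℝ}
    (hg : Integrable g P) (t : Fin (K + 1)) : Integrable (fun ω => r t (X 0 ω) * g ω) P := by
  refine hg.bdd_mul (c := 1) ((h.measurable_r t).comp (h.measurable_X 0)).aestronglyMeasurable ?_
  filter_upwards [h.ae_mem_Icc_gps t] with ω hω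
  rw [Real.norm_of_nonneg (h.rmin_pos.le.trans hω.1)]
  exact hω.2

theorem integral_ind_mul (h : LinearModel P D X T noise σ r rmin f φ β) {g : Covariate d → ℝ}
    (hg : Measurable g) (hgi : Integrable (fun ω => g (X 0 ω)) P) (t : Fin (K + 1)) :
    ∫ ω, ind (T 0 ω) t * g (X 0 ω) ∂P = ∫ ω, r t (X 0 ω) * g (X 0 ω) ∂P := by
  have hle := (h.measurable_X 0).comap_le
  have hset : MeasurableSet {ω | T 0 ω = t} := h.measurable_T 0 (measurableSet_singleton t)
  have hind : (fun ω => ind (T 0 ω) t * g (X 0 ω)) =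
      Set.indicator {ω | T 0 ω = t} (fun _ => (1 : ℝ)) * fun ω => g (X 0 ω) := by
    funext ω
    by_cases ht : T 0 ω = t
    · simp [ind, ht]
    · simp [ind, ht]
  have hint := h.integrable_ind_mul hgi t
  rw [hind] at hint ⊢
  have hgm : StronglyMeasurable[MeasurableSpace.comap (X 0) inferInstance] fun ω => g (X 0 ω) :=
    (hg.comp (comap_measurable (X 0))).stronglyMeasurable
  rw [← integral_condExp hle]
  refine integral_congr_ae ?_
  filter_upwards [condExp_mul_of_stronglyMeasurable_right hgm hint
    ((integrable_const _).indicator hset), h.gps t] with ω h1 h2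
  rw [h1, Pi.mul_apply, h2]

theorem integral_covariate_treatment (h : LinearModel P D X T noise σ r rmin f φ β)
    (hc : ∀ t, Measurable fun x => c x t) (hci : ∀ t, Integrable (fun ω => c (X 0 ω) t) P) :
    ∫ ω, c (X 0 ω) (T 0 ω) ∂P = ∫ ω, ∑ t, r t (X 0 ω) * c (X 0 ω) t ∂P := by
  simp_rw [← sum_ind_mul (T 0 _) (c (X 0 _))]
  rw [integral_finsetSum _ fun t _ => h.integrable_ind_mul (hci t) t,
    integral_finsetSum _ fun t _ => h.integrable_gps_mul (hci t) t]
  exact Finset.sum_congr rfl fun t _ => h.integral_ind_mul (hc t) (hci t) t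

/-- Given `X`, the treatment is averaged against the propensities and the noise term has mean zero.
-/
theorem condExp_covariate_treatment_noise (h : LinearModel P D X T noise σ r rmin f φ β)
    {s : Covariate d → Fin (K + 1) → ℝ}
    (hc : ∀ t, Measurable fun x => c x t) (hci : ∀ t, Integrable (fun ω => c (X 0 ω) t) P)
    (hs : ∀ t, Measurable fun x => s x t) (hsi : ∀ t, Integrable (fun ω => s (X 0 ω) t) P) :
    P[fun ω => c (X 0 ω) (T 0 ω) + s (X 0 ω) (T 0 ω) * noise 0 (T 0 ω) ω |
      MeasurableSpace.comap (X 0) inferInstance] =ᵐ[P]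
      fun ω => ∑ t, r t (X 0 ω) * c (X 0 ω) t := by
  have hle := (h.measurable_X 0).comap_le
  have hri : Integrable (fun ω => ∑ t, r t (X 0 ω) * c (X 0 ω) t) P :=
    integrable_finsetSum _ fun t _ => h.integrable_gps_mul (hci t) t
  refine (ae_eq_condExp_of_forall_setIntegral_eq hle
    ((h.integrable_covariate_treatment hci).add (h.integral_mul_noise hs hsi).1)
    (fun _ _ _ => hri.integrableOn) ?_ ?_).symm
  -- Multiplying both coefficients by the indicator of `A` turns the integral over `X ∈ A` into an
  -- unrestricted one, to which the moment formulas apply.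
  · rintro _ ⟨A, hA, rfl⟩ -
    have hAm := h.measurable_X 0 hA
    have hind : ∀ {g : Covariate d → Fin (K + 1) → ℝ} (t : Fin (K + 1)),
        Integrable (fun ω => g (X 0 ω) t) P →
        Integrable (fun ω => A.indicator (fun x => g x t) (X 0 ω)) P := fun t hg =>
      (hg.indicator hAm).congr (.of_forall fun ω => rfl)
    rw [integral_add' (h.integrable_covariate_treatment hci).integrableOn
      (h.integral_mul_noise hs hsi).1.integrableOn]
    have h1 := h.integral_covariate_treatment (c := fun x t => A.indicator (fun x => c x t) x)
      (fun t => (hc t).indicator hA) (fun t => hind t (hci t))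
    have h2 := (h.integral_mul_noise (c := fun x t => A.indicator (fun x => s x t) x)
      (fun t => (hs t).indicator hA) (fun t => hind t (hsi t))).2
    rw [← integral_indicator hAm, ← integral_indicator hAm, ← integral_indicator hAm]
    have e1 : ((X 0 ⁻¹' A).indicator fun ω => c (X 0 ω) (T 0 ω)) =
        fun ω => A.indicator (fun x => c x (T 0 ω)) (X 0 ω) := rfl
    have e2 : ((X 0 ⁻¹' A).indicator fun ω => s (X 0 ω) (T 0 ω) * noise 0 (T 0 ω) ω) =
        fun ω => A.indicator (fun x => s x (T 0 ω)) (X 0 ω) * noise 0 (T 0 ω) ω := by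
      funext ω
      by_cases hω : X 0 ω ∈ A
      · simp [Set.indicator, hω]
      · simp [Set.indicator, hω]
    have e3 : ((X 0 ⁻¹' A).indicator fun ω => ∑ t, r t (X 0 ω) * c (X 0 ω) t) =
        fun ω => ∑ t, r t (X 0 ω) * A.indicator (fun x => c x t) (X 0 ω) := by
      funext ω
      by_cases hω : X 0 ω ∈ A
      · simp [Set.indicator, hω]
      · simp [Set.indicator, hω]
    rw [e1, e2, e3, h1, h2, add_zero]
  · have hm : Measurable fun x => ∑ t, r t x * c x t :=
      Finset.measurable_fun_sum _ fun t _ => (h.measurable_r t).mul (hc t)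
    exact (hm.comp (comap_measurable (X 0))).stronglyMeasurable.aestronglyMeasurable

theorem ae_sum_gps_eq_one (h : LinearModel P D X T noise σ r rmin f φ β) :
    ∀ᵐ ω ∂P, ∑ t, r t (X 0 ω) = 1 := by
  have := h.condExp_covariate_treatment_noise (c := fun _ _ => 1) (s := fun _ _ => 0)
    (fun _ => measurable_const) (fun _ => integrable_const _) (fun _ => measurable_const)
    (fun _ => integrable_const _)
  simp only [zero_mul, add_zero, mul_one] at this
  rw [condExp_const (h.measurable_X 0).comap_le] at this
  filter_upwards [this] with ω hω using hω.symm

theorem condExp_noise (h : LinearModel P D X T noise σ r rmin f φ β) (t : Fin (K + 1)) :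
    P[noise 0 t | MeasurableSpace.comap (X 0) inferInstance] =ᵐ[P] 0 := by
  have hind : IndepFun (noise 0 t) (X 0) P :=
    (h.noise_indep_XT.comp (φ := Prod.fst) (ψ := fun e : Fin (K + 1) → ℝ => e t)
      measurable_fst (measurable_pi_apply t)).symm
  have hmean : ∫ ω, noise 0 t ω ∂P = 0 := by
    rw [(h.noise_law t).integral_eq, integral_id_gaussianReal]
  have := condExp_indep_eq (h.measurable_noise 0 t).comap_le (h.measurable_X 0).comap_le
    (comap_measurable (noise 0 t)).stronglyMeasurable ((IndepFun_iff_Indep _ _ _).1 hind)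
  rw [hmean] at this
  exact this

end LinearModel

/-! ### Pseudo-outcomes as affine functions of the outcome -/

section PseudoOutcome

variable {d K p : ℕ} {rhat muhat : Fin (K + 1) → Covariate d → ℝ} {k : Fin (K + 1)}

/-- The linear outcome model `∑ j, β_{t,j} φ_j(x)`. -/
noncomputable def linearOutcome (φ : Fin p → Covariate d → ℝ) (β : Fin (K + 1) → Fin p → ℝ)
    (t : Fin (K + 1)) (x : Covariate d) : ℝ :=
  ∑ j, β t j * φ j x

theorem linearOutcome_sub (φ : Fin p → Covariate d → ℝ) (β : Fin (K + 1) → Fin p → ℝ)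
    (s t : Fin (K + 1)) (x : Covariate d) :
    linearOutcome φ β s x - linearOutcome φ β t x = ∑ j, φ j x * (β s - β t) j := by
  rw [linearOutcome, linearOutcome, ← Finset.sum_sub_distrib]
  refine Finset.sum_congr rfl fun j _ => ?_
  rw [Pi.sub_apply]
  ring

/-- The coefficient of the outcome in the pseudo-outcome. -/
noncomputable def outcomeCoeff (rhat : Fin (K + 1) → Covariate d → ℝ) (k : Fin (K + 1)) :
    Learner → Covariate d → Fin (K + 1) → ℝ
  | .M, x, T => ind T k / rhat k x - ind T 0 / rhat 0 x
  | .DR, x, T => ind T k / rhat k x - ind T 0 / rhat 0 x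
  | .X, _, T => ind T k - ∑ l ∈ Finset.univ.erase k, ind T l

/-- This isolates the noise in the residual, with a coefficient that depends on `(X, T)` only. -/
theorem pseudoOutcome_add (ℓ : Learner) (x : Covariate d) (T : Fin (K + 1)) (y e : ℝ) :
    pseudoOutcome rhat muhat k ℓ x T (y + e) =
      pseudoOutcome rhat muhat k ℓ x T y + outcomeCoeff rhat k ℓ x T * e := by
  cases ℓ <;> simp only [pseudoOutcome, outcomeCoeff] <;> ring

theorem measurable_outcomeCoeff (hr : ∀ t, Measurable (rhat t)) (ℓ : Learner) (t : Fin (K + 1)) :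
    Measurable fun x => outcomeCoeff rhat k ℓ x t := by
  cases ℓ <;> simp only [outcomeCoeff] <;> fun_prop

theorem measurable_pseudoOutcome {α : Type*} [MeasurableSpace α] (hr : ∀ t, Measurable (rhat t))
    (hm : ∀ t, Measurable (muhat t)) {x : α → Covariate d} (hx : Measurable x) {y : α → ℝ}
    (hy : Measurable y) (ℓ : Learner) (t : Fin (K + 1)) :
    Measurable fun a => pseudoOutcome rhat muhat k ℓ (x a) t (y a) := by
  cases ℓ <;> simp only [pseudoOutcome] <;> fun_prop

theorem sum_erase_ind_mul (k s : Fin (K + 1)) (g : Fin (K + 1) → ℝ) :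
    ∑ l ∈ Finset.univ.erase k, ind s l * g l = if s = k then 0 else g s := by
  simp only [ind, ite_mul, one_mul, zero_mul]
  rw [Finset.sum_ite_eq]
  simp

theorem sum_erase_ind (k s : Fin (K + 1)) :
    ∑ l ∈ Finset.univ.erase k, ind s l = if s = k then 0 else 1 := by
  simpa using sum_erase_ind_mul k s fun _ => 1

theorem pseudoOutcome_X (x : Covariate d) (T : Fin (K + 1)) (y : ℝ) :
    pseudoOutcome rhat muhat k .X x T y =
      if T = k then y - muhat 0 x else muhat k x - y + (muhat T x - muhat 0 x) := by
  simp only [pseudoOutcome, sum_erase_ind, sum_erase_ind_mul k T fun l => muhat l x - muhat 0 x]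
  by_cases h : T = k
  · simp [h, ind]
  · simp [h, ind]

/-- The coefficient is `1` on `T = k` and `-1` elsewhere, so the X-learner does not inflate the
noise variance. -/
theorem outcomeCoeff_X_sq (x : Covariate d) (T : Fin (K + 1)) :
    outcomeCoeff rhat k .X x T ^ 2 = 1 := by
  simp only [outcomeCoeff, sum_erase_ind]
  by_cases h : T = k
  · simp [h, ind]
  · simp [h, ind]

/-- The pseudo-outcome of a unit less the linear model of its effect. -/
noncomputable def unitResidual (φ : Fin p → Covariate d → ℝ) (β : Fin (K + 1) → Fin p → ℝ)
    (rhat muhat : Fin (K + 1) → Covariate d → ℝ) (k : Fin (K + 1)) (ℓ : Learner)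
    (u : Covariate d × Fin (K + 1) × (Fin (K + 1) → ℝ)) : ℝ :=
  pseudoOutcome rhat muhat k ℓ u.1 u.2.1 (linearOutcome φ β u.2.1 u.1 + u.2.2 u.2.1) -
    ∑ j, φ j u.1 * (β k - β 0) j

variable {φ : Fin p → Covariate d → ℝ} {β : Fin (K + 1) → Fin p → ℝ}

theorem measurable_linearOutcome (hφ : ∀ j, Measurable (φ j)) (t : Fin (K + 1)) :
    Measurable (linearOutcome φ β t) :=
  Finset.measurable_fun_sum _ fun j _ => (hφ j).const_mul _

theorem measurable_unitResidual (hφ : ∀ j, Measurable (φ j)) (hr : ∀ t, Measurable (rhat t))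
    (hm : ∀ t, Measurable (muhat t)) (ℓ : Learner) :
    Measurable (unitResidual φ β rhat muhat k ℓ) := by
  have hL := fun t => measurable_linearOutcome (β := β) hφ t
  -- With the treatment as last coordinate, measurability can be checked separately at each of the
  -- finitely many levels.
  have h1 : Measurable fun q : (Covariate d × (Fin (K + 1) → ℝ)) × Fin (K + 1) =>
      unitResidual φ β rhat muhat k ℓ (q.1.1, q.2, q.1.2) := by
    refine measurable_from_prod_countable_left fun t => Measurable.sub ?_ (by fun_prop)
    exact measurable_pseudoOutcome hr hm measurable_fst
      (((hL t).comp measurable_fst).add ((measurable_pi_apply t).comp measurable_snd)) ℓ t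
  exact h1.comp (g := _) (f := fun u : Covariate d × Fin (K + 1) × (Fin (K + 1) → ℝ) =>
    ((u.1, u.2.2), u.2.1)) (by fun_prop)

end PseudoOutcome

/-! ### Residuals and well-specification -/

namespace LinearModel

variable {Ω : Type*} [MeasurableSpace Ω] {P : Measure Ω} {d K p : ℕ}
  {D : Set (Covariate d)} {X : ℕ → Ω → Covariate d} {T : ℕ → Ω → Fin (K + 1)}
  {noise : ℕ → Fin (K + 1) → Ω → ℝ} {σ : ℝ≥0} {r : Fin (K + 1) → Covariate d → ℝ} {rmin : ℝ}
  {f : Fin (K + 1) → Covariate d → ℝ} {φ : Fin p → Covariate d → ℝ} {β : Fin (K + 1) → Fin p → ℝ}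
  {rhat muhat : Fin (K + 1) → Covariate d → ℝ} {k : Fin (K + 1)} {M : ℝ}

/-- The residual of the pseudo-outcome of unit `i`. -/
noncomputable def residual (X : ℕ → Ω → Covariate d) (T : ℕ → Ω → Fin (K + 1))
    (noise : ℕ → Fin (K + 1) → Ω → ℝ) (φ : Fin p → Covariate d → ℝ) (β : Fin (K + 1) → Fin p → ℝ)
    (rhat muhat : Fin (K + 1) → Covariate d → ℝ) (k : Fin (K + 1)) (ℓ : Learner)
    (i : ℕ) (ω : Ω) : ℝ :=
  unitResidual φ β rhat muhat k ℓ (X i ω, T i ω, fun t => noise i t ω)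

/-- Nothing is assumed about `f` off `D`, not even measurability; the linear version is measurable
everywhere and replaces it. -/
theorem ae_eq_linearOutcome (h : LinearModel P D X T noise σ r rmin f φ β) (i : ℕ) :
    ∀ᵐ ω ∂P, ∀ t, f t (X i ω) = linearOutcome φ β t (X i ω) := by
  filter_upwards [h.mem_D i] with ω hω t using h.linear t _ hω

theorem Z_ae_eq (h : LinearModel P D X T noise σ r rmin f φ β) (ℓ : Learner) (i : ℕ) :
    Z f X T noise rhat muhat k ℓ i =ᵐ[P] fun ω =>
      ∑ j, φ j (X i ω) * (β k - β 0) j + residual X T noise φ β rhat muhat k ℓ i ω := by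
  filter_upwards [h.ae_eq_linearOutcome i] with ω hω
  simp only [Z, residual, unitResidual, observedOutcome, potentialOutcome, hω]
  ring

omit [MeasurableSpace Ω] in
theorem residual_eq (ℓ : Learner) (i : ℕ) (ω : Ω) :
    residual X T noise φ β rhat muhat k ℓ i ω =
      (pseudoOutcome rhat muhat k ℓ (X i ω) (T i ω) (linearOutcome φ β (T i ω) (X i ω)) -
        (linearOutcome φ β k (X i ω) - linearOutcome φ β 0 (X i ω))) +
        outcomeCoeff rhat k ℓ (X i ω) (T i ω) * noise i (T i ω) ω := by
  rw [residual, unitResidual, pseudoOutcome_add, linearOutcome_sub]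
  ring

section Integrability

variable (h : LinearModel P D X T noise σ r rmin f φ β) (hM : ∀ j, ∀ x ∈ D, |φ j x| ≤ M)
  (hN : Nuisance P D X rhat muhat)
include h

theorem memLp_linearOutcome [IsFiniteMeasure P] (hM : ∀ j, ∀ x ∈ D, |φ j x| ≤ M) (s : ENNReal)
    (t : Fin (K + 1)) : MemLp (fun ω => linearOutcome φ β t (X 0 ω)) s P := by
  refine memLp_finsetSum _ fun j _ => MemLp.const_mul (MemLp.of_bound
    ((h.measurable_φ j).comp (h.measurable_X 0)).aestronglyMeasurable M ?_) _
  filter_upwards [h.mem_D 0] with ω hω using hM j _ hω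

include hN

theorem memLp_inv_rhat [IsFiniteMeasure P] (s : ENNReal) (t : Fin (K + 1)) :
    MemLp (fun ω => (rhat t (X 0 ω))⁻¹) s P := by
  obtain ⟨ρ, hρ, hov⟩ := hN.overlap
  refine MemLp.of_bound
    ((hN.measurable_rhat t).inv.comp (h.measurable_X 0)).aestronglyMeasurable ρ⁻¹ ?_
  filter_upwards [h.mem_D 0] with ω hω
  rw [norm_inv, Real.norm_of_nonneg (hρ.le.trans (hov t _ hω))]
  exact inv_anti₀ hρ (hov t _ hω)

theorem memLp_outcomeCoeff [IsFiniteMeasure P] (ℓ : Learner) (s : ENNReal) (t : Fin (K + 1)) :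
    MemLp (fun ω => outcomeCoeff rhat k ℓ (X 0 ω) t) s P := by
  cases ℓ <;> simp only [outcomeCoeff, div_eq_mul_inv]
  · exact ((h.memLp_inv_rhat hN s k).const_mul _).sub ((h.memLp_inv_rhat hN s 0).const_mul _)
  · exact ((h.memLp_inv_rhat hN s k).const_mul _).sub ((h.memLp_inv_rhat hN s 0).const_mul _)
  · exact memLp_const _

include hM

theorem memLp_pseudoOutcome [IsFiniteMeasure P] (ℓ : Learner) (t : Fin (K + 1)) :
    MemLp (fun ω => pseudoOutcome rhat muhat k ℓ (X 0 ω) t (linearOutcome φ β t (X 0 ω))) 2 P := by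
  have hL := fun t => h.memLp_linearOutcome hM 2 t
  have hμ := hN.memLp
  have hinv : ∀ {g : Ω → ℝ} (l : Fin (K + 1)), MemLp g 2 P →
      MemLp (fun ω => g ω * (rhat l (X 0 ω))⁻¹) 2 P := fun l hg =>
    (h.memLp_inv_rhat hN ⊤ l).mul hg
  cases ℓ
  · have heq : (fun ω => pseudoOutcome rhat muhat k .M (X 0 ω) t (linearOutcome φ β t (X 0 ω))) =
        fun ω => ind t k * (linearOutcome φ β t (X 0 ω) * (rhat k (X 0 ω))⁻¹) -
          ind t 0 * (linearOutcome φ β t (X 0 ω) * (rhat 0 (X 0 ω))⁻¹) := by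
      funext ω
      simp only [pseudoOutcome]
      ring
    rw [heq]
    exact ((hinv k (hL t)).const_mul _).sub ((hinv 0 (hL t)).const_mul _)
  · have heq : (fun ω => pseudoOutcome rhat muhat k .DR (X 0 ω) t (linearOutcome φ β t (X 0 ω))) =
        fun ω => ind t k * ((linearOutcome φ β t (X 0 ω) - muhat t (X 0 ω)) * (rhat k (X 0 ω))⁻¹) +
          muhat k (X 0 ω) -
          ind t 0 * ((linearOutcome φ β t (X 0 ω) - muhat t (X 0 ω)) * (rhat 0 (X 0 ω))⁻¹) -
          muhat 0 (X 0 ω) := by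
      funext ω
      simp only [pseudoOutcome]
      ring
    rw [heq]
    exact ((((hinv k ((hL t).sub (hμ t))).const_mul _).add (hμ k)).sub
      ((hinv 0 ((hL t).sub (hμ t))).const_mul _)).sub (hμ 0)
  · simp only [pseudoOutcome]
    exact ((((hL t).sub (hμ 0)).const_mul _).add (((hμ k).sub (hL t)).const_mul _)).add
      (memLp_finsetSum _ fun l _ => ((hμ l).sub (hμ 0)).const_mul _)

variable [IsProbabilityMeasure P]

theorem memLp_residual (ℓ : Learner) : MemLp (residual X T noise φ β rhat muhat k ℓ 0) 2 P := by
  have hm : Measurable fun ω => outcomeCoeff rhat k ℓ (X 0 ω) (T 0 ω) * noise 0 (T 0 ω) ω := by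
    refine (h.measurable_covariate_treatment
      (fun t => measurable_outcomeCoeff hN.measurable_rhat ℓ t) 0).mul ?_
    exact (measurable_from_prod_countable_left
      (f := fun q : (Fin (K + 1) → ℝ) × Fin (K + 1) => q.1 q.2)
      fun t => measurable_pi_apply t).comp
        ((measurable_pi_lambda _ fun t => h.measurable_noise 0 t).prodMk (h.measurable_T 0))
  have h1 : MemLp (fun ω => outcomeCoeff rhat k ℓ (X 0 ω) (T 0 ω) * noise 0 (T 0 ω) ω) 2 P := by
    rw [memLp_two_iff_integrable_sq hm.aestronglyMeasurable]
    simp_rw [mul_pow]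
    exact (h.integral_mul_noise_sq (c := fun x t => outcomeCoeff rhat k ℓ x t ^ 2)
      (fun t => (measurable_outcomeCoeff hN.measurable_rhat ℓ t).pow_const 2)
      (fun t => (h.memLp_outcomeCoeff hN ℓ 2 t).integrable_sq)).1
  have h2 := h.memLp_covariate_treatment (s := 2)
    (c := fun x t => pseudoOutcome rhat muhat k ℓ x t (linearOutcome φ β t x) -
      (linearOutcome φ β k x - linearOutcome φ β 0 x))
    (fun t => (h.memLp_pseudoOutcome hM hN ℓ t).sub
      ((h.memLp_linearOutcome hM 2 k).sub (h.memLp_linearOutcome hM 2 0)))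
  exact (h2.add h1).ae_eq (.of_forall fun ω => (residual_eq ℓ 0 ω).symm)

theorem condExp_residual (ℓ : Learner) :
    P[residual X T noise φ β rhat muhat k ℓ 0 | MeasurableSpace.comap (X 0) inferInstance] =ᵐ[P]
      fun ω => ∑ t, r t (X 0 ω) *
        (pseudoOutcome rhat muhat k ℓ (X 0 ω) t (linearOutcome φ β t (X 0 ω)) -
          (linearOutcome φ β k (X 0 ω) - linearOutcome φ β 0 (X 0 ω))) := by
  have hL := fun t => measurable_linearOutcome (β := β) h.measurable_φ t
  have := h.condExp_covariate_treatment_noise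
    (c := fun x t => pseudoOutcome rhat muhat k ℓ x t (linearOutcome φ β t x) -
      (linearOutcome φ β k x - linearOutcome φ β 0 x))
    (s := outcomeCoeff rhat k ℓ)
    (fun t => (measurable_pseudoOutcome hN.measurable_rhat hN.measurable_muhat measurable_id
      (hL t) ℓ t).sub ((hL k).sub (hL 0)))
    (fun t => ((h.memLp_pseudoOutcome hM hN ℓ t).sub
      ((h.memLp_linearOutcome hM 2 k).sub (h.memLp_linearOutcome hM 2 0))).integrable (by norm_num))
    (fun t => measurable_outcomeCoeff hN.measurable_rhat ℓ t)
    (fun t => (h.memLp_outcomeCoeff hN ℓ 1 t).integrable le_rfl)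
  simp_rw [← residual_eq] at this
  exact this

/-- Here `τ(X)` is a function of `X`, and it is the conditional effect because the noises have
conditional mean zero. Since `Z = τ(X) + R`, the two conditional means differ by `E[R | X]`. -/
theorem wellSpecified_iff (ℓ : Learner) :
    WellSpecified P f X T noise rhat muhat k ℓ ↔
      P[residual X T noise φ β rhat muhat k ℓ 0 |
        MeasurableSpace.comap (X 0) inferInstance] =ᵐ[P] 0 := by
  have hle := (h.measurable_X 0).comap_le
  set τ : Covariate d → ℝ := fun x => linearOutcome φ β k x - linearOutcome φ β 0 x with hτ
  have hτm : Measurable τ := (measurable_linearOutcome h.measurable_φ k).sub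
    (measurable_linearOutcome h.measurable_φ 0)
  have hτi : Integrable (fun ω => τ (X 0 ω)) P :=
    ((h.memLp_linearOutcome hM 1 k).sub (h.memLp_linearOutcome hM 1 0)).integrable le_rfl
  have hτc : P[fun ω => τ (X 0 ω) | MeasurableSpace.comap (X 0) inferInstance] =
      fun ω => τ (X 0 ω) :=
    condExp_of_stronglyMeasurable hle (hτm.comp (comap_measurable (X 0))).stronglyMeasurable hτi
  have hZ : P[Z f X T noise rhat muhat k ℓ 0 | MeasurableSpace.comap (X 0) inferInstance] =ᵐ[P]
      (fun ω => τ (X 0 ω)) + P[residual X T noise φ β rhat muhat k ℓ 0 |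
        MeasurableSpace.comap (X 0) inferInstance] := by
    have h1 : Z f X T noise rhat muhat k ℓ 0 =ᵐ[P]
        (fun ω => τ (X 0 ω)) + residual X T noise φ β rhat muhat k ℓ 0 := by
      filter_upwards [h.Z_ae_eq (k := k) (rhat := rhat) (muhat := muhat) ℓ 0] with ω hω
      simp only [hω, Pi.add_apply, hτ, linearOutcome_sub]
    refine (condExp_congr_ae h1).trans ?_
    refine (condExp_add hτi ((h.memLp_residual hM hN ℓ).integrable (by norm_num)) _).trans ?_
    rw [hτc]
  have hni : ∀ t, Integrable (noise 0 t) P := fun t => by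
    have := (memLp_id_gaussianReal (μ := 0) (v := σ ^ 2) 1).integrable le_rfl
    rw [← (h.noise_law t).map_eq] at this
    exact (integrable_map_measure aestronglyMeasurable_id
      (h.measurable_noise 0 t).aemeasurable).1 this
  have hY : P[fun ω => potentialOutcome f X noise 0 k ω - potentialOutcome f X noise 0 0 ω |
      MeasurableSpace.comap (X 0) inferInstance] =ᵐ[P] fun ω => τ (X 0 ω) := by
    have h1 : (fun ω => potentialOutcome f X noise 0 k ω - potentialOutcome f X noise 0 0 ω) =ᵐ[P]
        (fun ω => τ (X 0 ω)) + (noise 0 k - noise 0 0) := by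
      filter_upwards [h.ae_eq_linearOutcome 0] with ω hω
      simp only [potentialOutcome, hω, Pi.add_apply, Pi.sub_apply, hτ]
      ring
    refine (condExp_congr_ae h1).trans ?_
    refine (condExp_add hτi ((hni k).sub (hni 0)) _).trans ?_
    rw [hτc]
    filter_upwards [condExp_sub (hni k) (hni 0) (MeasurableSpace.comap (X 0) inferInstance),
      h.condExp_noise k, h.condExp_noise 0] with ω h2 h3 h4
    rw [Pi.add_apply, h2, Pi.sub_apply, h3, h4]
    simp
  constructor
  · intro hW
    filter_upwards [hW, hZ, hY] with ω h1 h2 h3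
    rw [h2, h3, Pi.add_apply] at h1
    simpa using h1
  · intro hR
    refine hZ.trans (EventuallyEq.trans ?_ hY.symm)
    filter_upwards [hR] with ω h1
    rw [Pi.add_apply, h1]
    simp

theorem centeredErrors_residual {ℓ : Learner}
    (hW : WellSpecified P f X T noise rhat muhat k ℓ) :
    CenteredErrors P X (residual X T noise φ β rhat muhat k ℓ) := by
  have hu : Measurable (unitResidual φ β rhat muhat k ℓ) :=
    measurable_unitResidual h.measurable_φ hN.measurable_rhat hN.measurable_muhat ℓ
  have hpair : Measurable fun u => (u.1, unitResidual φ β rhat muhat k ℓ u) :=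
    measurable_fst.prodMk hu
  exact {
    measurable_X := h.measurable_X
    measurable_R := fun i => hu.comp ((h.measurable_X i).prodMk ((h.measurable_T i).prodMk
      (measurable_pi_lambda _ fun t => h.measurable_noise i t)))
    indep := h.indep.comp (fun _ u => (u.1, unitResidual φ β rhat muhat k ℓ u)) fun _ => hpair
    ident := fun i => (h.ident i).comp hpair
    memLp := h.memLp_residual hM hN ℓ
    condExp_eq_zero := (h.wellSpecified_iff hM hN ℓ).1 hW }

theorem wellSpecified_of_ae (ℓ : Learner)
    (hW : ∀ᵐ ω ∂P, ∑ t, r t (X 0 ω) *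
        (pseudoOutcome rhat muhat k ℓ (X 0 ω) t (linearOutcome φ β t (X 0 ω)) -
          (linearOutcome φ β k (X 0 ω) - linearOutcome φ β 0 (X 0 ω))) = 0) :
    WellSpecified P f X T noise rhat muhat k ℓ := by
  rw [h.wellSpecified_iff hM hN]
  exact (h.condExp_residual hM hN ℓ).trans hW

/-- The propensity cancels the inverse weight at levels `k` and `0`, leaving the difference of the
two outcome models. -/
theorem wellSpecified_M_of_rhat (hr : ∀ t, ∀ᵐ ω ∂P, rhat t (X 0 ω) = r t (X 0 ω)) :
    WellSpecified P f X T noise rhat muhat k .M := by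
  refine h.wellSpecified_of_ae hM hN .M ?_
  filter_upwards [ae_all_iff.2 hr, h.ae_sum_gps_eq_one, ae_all_iff.2 h.ae_mem_Icc_gps]
    with ω h1 h2 h3
  have hne : ∀ t, r t (X 0 ω) ≠ 0 := fun t => (h.rmin_pos.trans_le (h3 t).1).ne'
  simp_rw [mul_sub]
  rw [Finset.sum_sub_distrib, Finset.sum_sub_distrib, ← Finset.sum_mul, ← Finset.sum_mul, h2]
  simp only [pseudoOutcome, h1, ind, mul_sub, Finset.sum_sub_distrib, ite_div, zero_div, ite_mul,
    zero_mul, mul_ite, mul_zero, Finset.sum_ite_eq', Finset.mem_univ, if_true]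
  field_simp [hne k, hne 0]
  ring

/-- Correct weights recover the errors of `muhat` at `k` and `0`, which exactly correct the plug-in
difference. -/
theorem wellSpecified_DR_of_rhat (hr : ∀ t, ∀ᵐ ω ∂P, rhat t (X 0 ω) = r t (X 0 ω)) :
    WellSpecified P f X T noise rhat muhat k .DR := by
  refine h.wellSpecified_of_ae hM hN .DR ?_
  filter_upwards [ae_all_iff.2 hr, h.ae_sum_gps_eq_one, ae_all_iff.2 h.ae_mem_Icc_gps]
    with ω h1 h2 h3
  have hne : ∀ t, r t (X 0 ω) ≠ 0 := fun t => (h.rmin_pos.trans_le (h3 t).1).ne'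
  simp_rw [mul_sub]
  rw [Finset.sum_sub_distrib, Finset.sum_sub_distrib, ← Finset.sum_mul, ← Finset.sum_mul, h2]
  simp only [pseudoOutcome, h1, ind, mul_sub, mul_add, Finset.sum_sub_distrib,
    Finset.sum_add_distrib, mul_ite, mul_one, mul_zero, Finset.sum_ite_eq', Finset.mem_univ,
    if_true, ← Finset.sum_mul, h2]
  field_simp [hne k, hne 0]
  ring

/-- The weights multiply `f - muhat = 0`, so the noiseless residual vanishes at every level whatever
`rhat` is. -/
theorem wellSpecified_DR_of_muhat (hμ : ∀ t, ∀ᵐ ω ∂P, muhat t (X 0 ω) = f t (X 0 ω)) :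
    WellSpecified P f X T noise rhat muhat k .DR := by
  refine h.wellSpecified_of_ae hM hN .DR ?_
  filter_upwards [ae_all_iff.2 hμ, h.ae_eq_linearOutcome 0] with ω h1 h2
  refine Finset.sum_eq_zero fun t _ => ?_
  simp only [pseudoOutcome, h1, h2]
  ring

theorem wellSpecified_X_of_muhat (hμ : ∀ t, ∀ᵐ ω ∂P, muhat t (X 0 ω) = f t (X 0 ω)) :
    WellSpecified P f X T noise rhat muhat k .X := by
  refine h.wellSpecified_of_ae hM hN .X ?_
  filter_upwards [ae_all_iff.2 hμ, h.ae_eq_linearOutcome 0] with ω h1 h2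
  refine Finset.sum_eq_zero fun t _ => ?_
  rw [pseudoOutcome_X, h1, h1, h1, h2, h2, h2]
  split_ifs with htk
  · subst htk; ring
  · ring

end Integrability

end LinearModel

/-! ### Second moments of the residuals -/

variable {Ω : Type*} [MeasurableSpace Ω] {P : Measure Ω} {d K p : ℕ}
  {D : Set (Covariate d)} {X : ℕ → Ω → Covariate d} {T : ℕ → Ω → Fin (K + 1)}
  {noise : ℕ → Fin (K + 1) → Ω → ℝ} {σ : ℝ≥0} {r : Fin (K + 1) → Covariate d → ℝ} {rmin : ℝ}
  {f : Fin (K + 1) → Covariate d → ℝ} {φ : Fin p → Covariate d → ℝ} {β : Fin (K + 1) → Fin p → ℝ}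
  {rhat muhat : Fin (K + 1) → Covariate d → ℝ} {k : Fin (K + 1)} {M : ℝ}

theorem integral_add_add {u v w : Ω → ℝ} (hu : Integrable u P) (hv : Integrable v P)
    (hw : Integrable w P) :
    ∫ ω, (u ω + v ω + w ω) ∂P = ∫ ω, u ω ∂P + ∫ ω, v ω ∂P + ∫ ω, w ω ∂P := by
  rw [integral_add (f := fun ω => u ω + v ω) (hu.add hv) hw, integral_add hu hv]

theorem integral_add_add_add {u v w w' : Ω → ℝ} (hu : Integrable u P) (hv : Integrable v P)
    (hw : Integrable w P) (hw' : Integrable w' P) :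
    ∫ ω, (u ω + v ω + (w ω + w' ω)) ∂P =
      ∫ ω, u ω ∂P + ∫ ω, v ω ∂P + (∫ ω, w ω ∂P + ∫ ω, w' ω ∂P) := by
  rw [integral_add_add (w := fun ω => w ω + w' ω) hu hv (hw.add hw'), integral_add hw hw']

/-- Each coordinate of `F⁻¹ φ(X)` is a sum of `p` terms of size at most `L M`, so only `E[R²]`
remains to be estimated. -/
theorem abs_momentMatrix_influence_le {x : Ω → Covariate d} {R : Ω → ℝ} {L : ℝ}
    {F : Matrix (Fin p) (Fin p) ℝ} (hR : Integrable (fun ω => R ω ^ 2) P)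
    (hM : ∀ᵐ ω ∂P, ∀ j, |φ j (x ω)| ≤ M) (hL : ∀ i j, |F⁻¹ i j| ≤ L) (i j : Fin p) :
    |momentMatrix P (fun ω => CenteredErrors.influence F φ (x ω) (R ω)) i j| ≤
      (p * (L * M)) ^ 2 * ∫ ω, R ω ^ 2 ∂P := by
  rw [momentMatrix, Matrix.of_apply, ← integral_const_mul]
  refine (abs_integral_le_integral_abs).trans (integral_mono_of_nonneg
    (.of_forall fun ω => abs_nonneg _) (hR.const_mul _) ?_)
  filter_upwards [hM] with ω hω
  have hb : ∀ i, |F⁻¹.mulVec (fun l => φ l (x ω)) i| ≤ p * (L * M) := fun i => by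
    rw [Matrix.mulVec, dotProduct]
    refine (Finset.abs_sum_le_sum_abs _ _).trans ?_
    calc ∑ l, |F⁻¹ i l * φ l (x ω)| ≤ ∑ _l : Fin p, L * M := Finset.sum_le_sum fun l _ => by
          rw [abs_mul]
          exact mul_le_mul (hL i l) (hω l) (abs_nonneg _) ((abs_nonneg _).trans (hL i l))
      _ = p * (L * M) := by simp
  simp only [CenteredErrors.influence]
  have hmul := mul_le_mul (hb i) (hb j) (abs_nonneg _) ((abs_nonneg _).trans (hb i))
  calc |F⁻¹.mulVec (fun l => φ l (x ω)) i * R ω * (F⁻¹.mulVec (fun l => φ l (x ω)) j * R ω)|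
      = |F⁻¹.mulVec (fun l => φ l (x ω)) i| * |F⁻¹.mulVec (fun l => φ l (x ω)) j| * R ω ^ 2 := by
        rw [← sq_abs (R ω), abs_mul, abs_mul, abs_mul]
        ring
    _ ≤ (p * (L * M)) ^ 2 * R ω ^ 2 := by
        rw [sq (p * (L * M))]
        exact mul_le_mul_of_nonneg_right hmul (sq_nonneg _)

namespace LinearModel

variable [IsProbabilityMeasure P] (h : LinearModel P D X T noise σ r rmin f φ β)
  (hM : ∀ j, ∀ x ∈ D, |φ j x| ≤ M) (hN : Nuisance P D X rhat muhat)
include h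

omit [IsProbabilityMeasure P] in
theorem err_eq (t : Fin (K + 1)) :
    err P X f muhat t = ∫ ω, (linearOutcome φ β t (X 0 ω) - muhat t (X 0 ω)) ^ 2 ∂P := by
  refine integral_congr_ae ?_
  filter_upwards [h.ae_eq_linearOutcome 0] with ω hω
  rw [hω t]

include hN

/-- As `k ≠ 0`, the two indicators never overlap and the square has no cross term. Averaging over
`T` turns each `1/r²` into `r · 1/r² = 1/r ≤ 1/rmin`. -/
theorem integral_outcomeCoeff_sq_mul_le (hk : k ≠ 0)
    (hr : ∀ t, ∀ᵐ ω ∂P, rhat t (X 0 ω) = r t (X 0 ω)) {g : Covariate d → Fin (K + 1) → ℝ}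
    (hg : ∀ t, Measurable fun x => g x t) (hgi : ∀ t, Integrable (fun ω => g (X 0 ω) t) P)
    (hg0 : ∀ x t, 0 ≤ g x t) :
    Integrable (fun ω => outcomeCoeff rhat k .M (X 0 ω) (T 0 ω) ^ 2 * g (X 0 ω) (T 0 ω)) P ∧
    ∫ ω, outcomeCoeff rhat k .M (X 0 ω) (T 0 ω) ^ 2 * g (X 0 ω) (T 0 ω) ∂P ≤
      (∫ ω, g (X 0 ω) k ∂P + ∫ ω, g (X 0 ω) 0 ∂P) / rmin := by
  have hi : ∀ t, Integrable (fun ω => outcomeCoeff rhat k .M (X 0 ω) t ^ 2 * g (X 0 ω) t) P :=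
    fun t => by
      have h1 := h.memLp_outcomeCoeff (k := k) hN .M ⊤ t
      have h2 : MemLp (fun ω => outcomeCoeff rhat k .M (X 0 ω) t * g (X 0 ω) t) 1 P :=
        (memLp_one_iff_integrable.2 (hgi t)).mul h1
      have h3 : MemLp (fun ω => outcomeCoeff rhat k .M (X 0 ω) t *
          (outcomeCoeff rhat k .M (X 0 ω) t * g (X 0 ω) t)) 1 P := h2.mul h1
      exact (memLp_one_iff_integrable.1 h3).congr (.of_forall fun ω => by ring)
  refine ⟨h.integrable_covariate_treatment
    (c := fun x t => outcomeCoeff rhat k .M x t ^ 2 * g x t) hi, ?_⟩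
  rw [h.integral_covariate_treatment (c := fun x t => outcomeCoeff rhat k .M x t ^ 2 * g x t)
    (fun t => ((measurable_outcomeCoeff hN.measurable_rhat .M t).pow_const 2).mul (hg t)) hi,
    ← integral_add (hgi k) (hgi 0), ← integral_div]
  refine integral_mono_ae (integrable_finsetSum _ fun t _ => h.integrable_gps_mul (hi t) t)
    (((hgi k).add (hgi 0)).div_const _) ?_
  filter_upwards [ae_all_iff.2 hr, ae_all_iff.2 h.ae_mem_Icc_gps] with ω h1 h2
  have hpos : ∀ t, 0 < r t (X 0 ω) := fun t => h.rmin_pos.trans_le (h2 t).1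
  have hterm : ∀ t, r t (X 0 ω) * (outcomeCoeff rhat k .M (X 0 ω) t ^ 2 * g (X 0 ω) t) =
      ind t k * (g (X 0 ω) t / r t (X 0 ω)) + ind t 0 * (g (X 0 ω) t / r t (X 0 ω)) := fun t => by
    have := (hpos t).ne'
    simp only [outcomeCoeff, h1]
    by_cases htk : t = k
    · subst htk
      rw [ind_self, ind_of_ne hk]
      field_simp
      ring
    · by_cases ht0 : t = 0
      · subst ht0
        rw [ind_self, ind_of_ne htk]
        field_simp
        ring
      · rw [ind_of_ne htk, ind_of_ne ht0]
        ring
  have hsum : ∑ t, r t (X 0 ω) * (outcomeCoeff rhat k .M (X 0 ω) t ^ 2 * g (X 0 ω) t) =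
      g (X 0 ω) k / r k (X 0 ω) + g (X 0 ω) 0 / r 0 (X 0 ω) := by
    simp_rw [hterm, ind, ite_mul, one_mul, zero_mul]
    rw [Finset.sum_add_distrib]
    simp
  change ∑ t, r t (X 0 ω) * (outcomeCoeff rhat k .M (X 0 ω) t ^ 2 * g (X 0 ω) t) ≤
    (g (X 0 ω) k + g (X 0 ω) 0) / rmin
  rw [hsum, add_div]
  exact add_le_add (div_le_div_of_nonneg_left (hg0 _ _) h.rmin_pos (h2 k).1)
    (div_le_div_of_nonneg_left (hg0 _ _) h.rmin_pos (h2 0).1)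

theorem integral_outcomeCoeff_mul_noise_sq_le (hk : k ≠ 0)
    (hr : ∀ t, ∀ᵐ ω ∂P, rhat t (X 0 ω) = r t (X 0 ω)) :
    Integrable (fun ω => (outcomeCoeff rhat k .M (X 0 ω) (T 0 ω) * noise 0 (T 0 ω) ω) ^ 2) P ∧
    ∫ ω, (outcomeCoeff rhat k .M (X 0 ω) (T 0 ω) * noise 0 (T 0 ω) ω) ^ 2 ∂P ≤
      2 * (σ : ℝ) ^ 2 / rmin := by
  have h1 := h.integral_mul_noise_sq (c := fun x t => outcomeCoeff rhat k .M x t ^ 2)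
    (fun t => (measurable_outcomeCoeff hN.measurable_rhat .M t).pow_const 2)
    (fun t => (h.memLp_outcomeCoeff hN .M 2 t).integrable_sq)
  have h2 := (h.integral_outcomeCoeff_sq_mul_le hN hk hr (g := fun _ _ => 1)
    (fun _ => measurable_const) (fun _ => integrable_const _) (fun _ _ => zero_le_one)).2
  simp_rw [mul_pow]
  refine ⟨h1.1, h1.2.le.trans ?_⟩
  simp only [mul_one, integral_const, probReal_univ, smul_eq_mul] at h2
  calc (σ : ℝ) ^ 2 * ∫ ω, outcomeCoeff rhat k .M (X 0 ω) (T 0 ω) ^ 2 ∂P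
      ≤ (σ : ℝ) ^ 2 * ((1 + 1) / rmin) := mul_le_mul_of_nonneg_left h2 (sq_nonneg _)
    _ = 2 * (σ : ℝ) ^ 2 / rmin := by ring

include hM

theorem integral_residual_M_sq_le (hk : k ≠ 0)
    (hr : ∀ t, ∀ᵐ ω ∂P, rhat t (X 0 ω) = r t (X 0 ω)) {B : ℝ} (hB : ∀ t, ∀ x ∈ D, |f t x| ≤ B) :
    ∫ ω, residual X T noise φ β rhat muhat k .M 0 ω ^ 2 ∂P ≤
      18 * ((B ^ 2 + (σ : ℝ) ^ 2) / rmin) := by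
  have hsq : ∀ t, ∀ᵐ ω ∂P, linearOutcome φ β t (X 0 ω) ^ 2 ≤ B ^ 2 := fun t => by
    filter_upwards [h.mem_D 0] with ω hω
    have := hB t _ hω
    rw [h.linear t _ hω] at this
    exact sq_le_sq' (neg_le_of_abs_le this) (le_of_abs_le this)
  have hLi : ∀ t, Integrable (fun ω => linearOutcome φ β t (X 0 ω) ^ 2) P := fun t =>
    (h.memLp_linearOutcome hM 2 t).integrable_sq
  have hLB : ∀ t, ∫ ω, linearOutcome φ β t (X 0 ω) ^ 2 ∂P ≤ B ^ 2 := fun t => by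
    simpa using integral_mono_ae (hLi t) (integrable_const (B ^ 2)) (hsq t)
  obtain ⟨ia, ha⟩ := h.integral_outcomeCoeff_sq_mul_le hN hk hr
    (g := fun x t => linearOutcome φ β t x ^ 2)
    (fun t => (measurable_linearOutcome h.measurable_φ t).pow_const 2) hLi
    (fun _ _ => sq_nonneg _)
  obtain ⟨ib, hb⟩ := h.integral_outcomeCoeff_mul_noise_sq_le hN hk hr
  have hpos := h.rmin_pos
  have hB2 : B ^ 2 ≤ B ^ 2 / rmin := le_div_self (sq_nonneg _) hpos h.rmin_le_one
  have ha' : ∫ ω, outcomeCoeff rhat k .M (X 0 ω) (T 0 ω) ^ 2 *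
      linearOutcome φ β (T 0 ω) (X 0 ω) ^ 2 ∂P ≤ 2 * (B ^ 2 / rmin) := by
    refine ha.trans ((div_le_div_of_nonneg_right (add_le_add (hLB k) (hLB 0)) hpos.le).trans ?_)
    exact le_of_eq (by ring)
  -- The residual is `u + v - τ`, with weighted outcome `u`, weighted noise `v` and effect `τ`,
  -- where `τ² ≤ 4B²`. Three-term Cauchy–Schwarz gives `6 B²/rmin` from `u`, `6 σ²/rmin` from `v`
  -- and `12 B² ≤ 12 B²/rmin` from `τ`, hence the constant `18`.
  calc ∫ ω, residual X T noise φ β rhat muhat k .M 0 ω ^ 2 ∂P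
      ≤ ∫ ω, (3 * (outcomeCoeff rhat k .M (X 0 ω) (T 0 ω) ^ 2 *
          linearOutcome φ β (T 0 ω) (X 0 ω) ^ 2) +
          3 * (outcomeCoeff rhat k .M (X 0 ω) (T 0 ω) * noise 0 (T 0 ω) ω) ^ 2 +
          12 * B ^ 2) ∂P := by
        refine integral_mono_ae (h.memLp_residual hM hN .M).integrable_sq
          (((ia.const_mul _).add (ib.const_mul _)).add (integrable_const _)) ?_
        filter_upwards [hsq k, hsq 0] with ω h1 h2
        rw [residual_eq]
        have h3 : pseudoOutcome rhat muhat k .M (X 0 ω) (T 0 ω) (linearOutcome φ β (T 0 ω) (X 0 ω))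
            = outcomeCoeff rhat k .M (X 0 ω) (T 0 ω) * linearOutcome φ β (T 0 ω) (X 0 ω) := by
          simp only [pseudoOutcome, outcomeCoeff]
          ring
        simp only [h3]
        generalize outcomeCoeff rhat k .M (X 0 ω) (T 0 ω) * noise 0 (T 0 ω) ω = v
        rw [← mul_pow]
        generalize outcomeCoeff rhat k .M (X 0 ω) (T 0 ω) * linearOutcome φ β (T 0 ω) (X 0 ω) = u
        generalize linearOutcome φ β k (X 0 ω) = a at *
        generalize linearOutcome φ β 0 (X 0 ω) = b at *
        nlinarith [sq_nonneg (u - v), sq_nonneg (u + (a - b)), sq_nonneg (v + (a - b)),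
          sq_nonneg (a + b)]
    _ ≤ 18 * ((B ^ 2 + (σ : ℝ) ^ 2) / rmin) := by
        rw [integral_add_add (ia.const_mul _) (ib.const_mul _) (integrable_const _),
          integral_const_mul, integral_const_mul, integral_const, probReal_univ, one_smul, add_div]
        have : 0 ≤ (σ : ℝ) ^ 2 / rmin := by positivity
        rw [mul_div_assoc] at hb
        linarith

theorem integral_residual_DR_sq_le (hk : k ≠ 0)
    (hr : ∀ t, ∀ᵐ ω ∂P, rhat t (X 0 ω) = r t (X 0 ω)) :
    ∫ ω, residual X T noise φ β rhat muhat k .DR 0 ω ^ 2 ∂P ≤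
      18 * ((err P X f muhat k + err P X f muhat 0 + (σ : ℝ) ^ 2) / rmin) := by
  have hgi : ∀ t, Integrable (fun ω => (linearOutcome φ β t (X 0 ω) - muhat t (X 0 ω)) ^ 2) P :=
    fun t => ((h.memLp_linearOutcome hM 2 t).sub (hN.memLp t)).integrable_sq
  obtain ⟨ia, ha⟩ := h.integral_outcomeCoeff_sq_mul_le hN hk hr
    (g := fun x t => (linearOutcome φ β t x - muhat t x) ^ 2)
    (fun t => ((measurable_linearOutcome h.measurable_φ t).sub (hN.measurable_muhat t)).pow_const 2)
    hgi (fun _ _ => sq_nonneg _)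
  obtain ⟨ib, hb⟩ := h.integral_outcomeCoeff_mul_noise_sq_le hN hk hr
  have hpos := h.rmin_pos
  rw [h.err_eq, h.err_eq]
  -- The residual is `u + v - a + b`: weighted model error, weighted noise, and the model errors at
  -- `k` and `0`. Four-term Cauchy–Schwarz gives a total coefficient of `8`; the constant `18` is
  -- kept for uniformity.
  calc ∫ ω, residual X T noise φ β rhat muhat k .DR 0 ω ^ 2 ∂P
      ≤ ∫ ω, (4 * (outcomeCoeff rhat k .M (X 0 ω) (T 0 ω) ^ 2 *
          (linearOutcome φ β (T 0 ω) (X 0 ω) - muhat (T 0 ω) (X 0 ω)) ^ 2) +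
          4 * (outcomeCoeff rhat k .M (X 0 ω) (T 0 ω) * noise 0 (T 0 ω) ω) ^ 2 +
          (4 * (linearOutcome φ β k (X 0 ω) - muhat k (X 0 ω)) ^ 2 +
          4 * (linearOutcome φ β 0 (X 0 ω) - muhat 0 (X 0 ω)) ^ 2)) ∂P := by
        refine integral_mono_ae (h.memLp_residual hM hN .DR).integrable_sq
          (((ia.const_mul _).add (ib.const_mul _)).add
            (((hgi k).const_mul _).add ((hgi 0).const_mul _))) (.of_forall fun ω => ?_)
        simp only [residual_eq]
        have h3 : pseudoOutcome rhat muhat k .DR (X 0 ω) (T 0 ω)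
            (linearOutcome φ β (T 0 ω) (X 0 ω)) -
            (linearOutcome φ β k (X 0 ω) - linearOutcome φ β 0 (X 0 ω)) =
            outcomeCoeff rhat k .M (X 0 ω) (T 0 ω) *
              (linearOutcome φ β (T 0 ω) (X 0 ω) - muhat (T 0 ω) (X 0 ω)) -
            (linearOutcome φ β k (X 0 ω) - muhat k (X 0 ω)) +
            (linearOutcome φ β 0 (X 0 ω) - muhat 0 (X 0 ω)) := by
          simp only [pseudoOutcome, outcomeCoeff]
          ring
        have h4 : outcomeCoeff rhat k .DR (X 0 ω) (T 0 ω) =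
          outcomeCoeff rhat k .M (X 0 ω) (T 0 ω) := rfl
        rw [h3, h4, ← mul_pow]
        generalize outcomeCoeff rhat k .M (X 0 ω) (T 0 ω) * noise 0 (T 0 ω) ω = v
        generalize outcomeCoeff rhat k .M (X 0 ω) (T 0 ω) *
          (linearOutcome φ β (T 0 ω) (X 0 ω) - muhat (T 0 ω) (X 0 ω)) = u
        generalize linearOutcome φ β k (X 0 ω) - muhat k (X 0 ω) = a
        generalize linearOutcome φ β 0 (X 0 ω) - muhat 0 (X 0 ω) = b
        nlinarith [sq_nonneg (u - v), sq_nonneg (u + a), sq_nonneg (u - b), sq_nonneg (v + a),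
          sq_nonneg (v - b), sq_nonneg (a + b)]
    _ ≤ 18 * ((∫ ω, (linearOutcome φ β k (X 0 ω) - muhat k (X 0 ω)) ^ 2 ∂P +
          ∫ ω, (linearOutcome φ β 0 (X 0 ω) - muhat 0 (X 0 ω)) ^ 2 ∂P + (σ : ℝ) ^ 2) / rmin) := by
        rw [integral_add_add_add (ia.const_mul _) (ib.const_mul _) ((hgi k).const_mul _)
            ((hgi 0).const_mul _), integral_const_mul,
          integral_const_mul, integral_const_mul, integral_const_mul]
        have e1 : 0 ≤ ∫ ω, (linearOutcome φ β k (X 0 ω) - muhat k (X 0 ω)) ^ 2 ∂P :=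
          integral_nonneg fun _ => sq_nonneg _
        have e2 : 0 ≤ ∫ ω, (linearOutcome φ β 0 (X 0 ω) - muhat 0 (X 0 ω)) ^ 2 ∂P :=
          integral_nonneg fun _ => sq_nonneg _
        have l1 := le_div_self e1 hpos h.rmin_le_one
        have l2 := le_div_self e2 hpos h.rmin_le_one
        have : 0 ≤ (σ : ℝ) ^ 2 / rmin := by positivity
        rw [mul_div_assoc] at hb
        rw [add_div] at ha ⊢
        rw [add_div]
        linarith

theorem integral_residual_X_sq_le (hk : k ≠ 0) :
    ∫ ω, residual X T noise φ β rhat muhat k .X 0 ω ^ 2 ∂P ≤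
      18 * (∑ l ∈ Finset.univ.erase k, err P X f muhat l + err P X f muhat k + (σ : ℝ) ^ 2) := by
  simp_rw [h.err_eq]
  have hgi : ∀ t, Integrable (fun ω => (linearOutcome φ β t (X 0 ω) - muhat t (X 0 ω)) ^ 2) P :=
    fun t => ((h.memLp_linearOutcome hM 2 t).sub (hN.memLp t)).integrable_sq
  have hnoise := h.integral_mul_noise_sq (c := fun _ _ => 1) (fun _ => measurable_const)
    (fun _ => integrable_const _)
  simp only [one_mul, integral_const, probReal_univ, smul_eq_mul, mul_one] at hnoise
  have hsi := integrable_finsetSum (Finset.univ.erase k) fun t _ => hgi t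
  have h0 : ∫ ω, (linearOutcome φ β 0 (X 0 ω) - muhat 0 (X 0 ω)) ^ 2 ∂P ≤
      ∑ l ∈ Finset.univ.erase k,
        ∫ ω, (linearOutcome φ β l (X 0 ω) - muhat l (X 0 ω)) ^ 2 ∂P :=
    Finset.single_le_sum (f := fun l =>
      ∫ ω, (linearOutcome φ β l (X 0 ω) - muhat l (X 0 ω)) ^ 2 ∂P)
      (fun l _ => integral_nonneg fun _ => sq_nonneg _)
      (Finset.mem_erase.2 ⟨hk.symm, Finset.mem_univ 0⟩)
  -- With model errors `a`, `b`, `u` at `k`, `0`, `T`, the residual is `b + v` on `T = k` and `b - a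
  -- - u + v` otherwise. In the second case `T ≠ k`, so `u²` is one term of the sum over `l ≠ k`;
  -- the error at `0` is later absorbed into that sum as well.
  calc ∫ ω, residual X T noise φ β rhat muhat k .X 0 ω ^ 2 ∂P
      ≤ ∫ ω, ((6 * (linearOutcome φ β k (X 0 ω) - muhat k (X 0 ω)) ^ 2 +
          6 * (linearOutcome φ β 0 (X 0 ω) - muhat 0 (X 0 ω)) ^ 2) +
          (6 * ∑ l ∈ Finset.univ.erase k, (linearOutcome φ β l (X 0 ω) - muhat l (X 0 ω)) ^ 2 +
          2 * noise 0 (T 0 ω) ω ^ 2)) ∂P := by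
        refine integral_mono_ae (h.memLp_residual hM hN .X).integrable_sq
          ((((hgi k).const_mul _).add ((hgi 0).const_mul _)).add
            ((hsi.const_mul _).add (hnoise.1.const_mul _))) (.of_forall fun ω => ?_)
        simp only [residual_eq, pseudoOutcome_X]
        have hc := outcomeCoeff_X_sq (rhat := rhat) (k := k) (X 0 ω) (T 0 ω)
        have hv : noise 0 (T 0 ω) ω ^ 2 =
            (outcomeCoeff rhat k .X (X 0 ω) (T 0 ω) * noise 0 (T 0 ω) ω) ^ 2 := by
          rw [mul_pow, hc, one_mul]
        have hS0 : 0 ≤ ∑ l ∈ Finset.univ.erase k,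
            (linearOutcome φ β l (X 0 ω) - muhat l (X 0 ω)) ^ 2 :=
          Finset.sum_nonneg fun _ _ => sq_nonneg _
        rw [hv]
        generalize outcomeCoeff rhat k .X (X 0 ω) (T 0 ω) * noise 0 (T 0 ω) ω = v
        split_ifs with hT
        · rw [hT]
          generalize ∑ l ∈ Finset.univ.erase k,
            (linearOutcome φ β l (X 0 ω) - muhat l (X 0 ω)) ^ 2 = S at *
          nlinarith [sq_nonneg (linearOutcome φ β 0 (X 0 ω) - muhat 0 (X 0 ω) - v),
            sq_nonneg (linearOutcome φ β 0 (X 0 ω) - muhat 0 (X 0 ω)),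
            sq_nonneg (linearOutcome φ β k (X 0 ω) - muhat k (X 0 ω))]
        · have hST := Finset.single_le_sum (f := fun l =>
            (linearOutcome φ β l (X 0 ω) - muhat l (X 0 ω)) ^ 2) (fun l _ => sq_nonneg _)
            (Finset.mem_erase.2 ⟨hT, Finset.mem_univ (T 0 ω)⟩)
          have h3 : muhat k (X 0 ω) - linearOutcome φ β (T 0 ω) (X 0 ω) +
              (muhat (T 0 ω) (X 0 ω) - muhat 0 (X 0 ω)) -
              (linearOutcome φ β k (X 0 ω) - linearOutcome φ β 0 (X 0 ω)) =
              (linearOutcome φ β 0 (X 0 ω) - muhat 0 (X 0 ω)) -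
              (linearOutcome φ β k (X 0 ω) - muhat k (X 0 ω)) -
              (linearOutcome φ β (T 0 ω) (X 0 ω) - muhat (T 0 ω) (X 0 ω)) := by ring
          rw [h3]
          generalize ∑ l ∈ Finset.univ.erase k,
            (linearOutcome φ β l (X 0 ω) - muhat l (X 0 ω)) ^ 2 = S at *
          generalize linearOutcome φ β (T 0 ω) (X 0 ω) - muhat (T 0 ω) (X 0 ω) = u at *
          generalize linearOutcome φ β k (X 0 ω) - muhat k (X 0 ω) = a
          generalize linearOutcome φ β 0 (X 0 ω) - muhat 0 (X 0 ω) = b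
          nlinarith [sq_nonneg (b - a - u - v), sq_nonneg (b + a), sq_nonneg (b + u),
            sq_nonneg (a - u)]
    _ ≤ _ := by
        rw [integral_add_add_add ((hgi k).const_mul _) ((hgi 0).const_mul _)
            (hsi.const_mul _) (hnoise.1.const_mul _), integral_const_mul,
          integral_const_mul, integral_const_mul, integral_const_mul, hnoise.2,
          integral_finsetSum _ fun t _ => hgi t]
        have e1 : 0 ≤ ∫ ω, (linearOutcome φ β k (X 0 ω) - muhat k (X 0 ω)) ^ 2 ∂P :=
          integral_nonneg fun _ => sq_nonneg _
        have e2 : 0 ≤ ∫ ω, (linearOutcome φ β 0 (X 0 ω) - muhat 0 (X 0 ω)) ^ 2 ∂P :=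
          integral_nonneg fun _ => sq_nonneg _
        have := sq_nonneg (σ : ℝ)
        linarith

end LinearModel

end MultiTreatment

/-! ### The main theorem -/

theorem theorem2 (p : ℕ) (M L ε : ℝ) (hε : 0 < ε) :
    ∃ c : ℝ, 0 < c ∧
      ∀ {Ω : Type*} [MeasurableSpace Ω] (P : Measure Ω) [IsProbabilityMeasure P] {d K : ℕ}
        (D : Set (MultiTreatment.Covariate d)) (X : ℕ → Ω → MultiTreatment.Covariate d)
        (T : ℕ → Ω → Fin (K + 1)) (noise : ℕ → Fin (K + 1) → Ω → ℝ) (σ : ℝ≥0)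
        (r : Fin (K + 1) → MultiTreatment.Covariate d → ℝ) (rmin : ℝ)
        (f : Fin (K + 1) → MultiTreatment.Covariate d → ℝ)
        (φ : Fin p → MultiTreatment.Covariate d → ℝ) (β : Fin (K + 1) → Fin p → ℝ)
        (rhat muhat : Fin (K + 1) → MultiTreatment.Covariate d → ℝ) (k : Fin (K + 1)),
        MultiTreatment.LinearModel P D X T noise σ r rmin f φ β →
        -- the basis functions are bounded and their second moment matrix is invertible
        (∀ j, ∀ x ∈ D, |φ j x| ≤ M) →
        IsUnit (MultiTreatment.secondMoment P φ X).det →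
        (∀ i j, |(MultiTreatment.secondMoment P φ X)⁻¹ i j| ≤ L) →
        MultiTreatment.Nuisance P D X rhat muhat →
        k ≠ 0 →
        -- correct nuisance functions are well-specified
        ((∀ t, ∀ᵐ ω ∂P, rhat t (X 0 ω) = r t (X 0 ω)) →
          MultiTreatment.WellSpecified P f X T noise rhat muhat k .M ∧
          MultiTreatment.WellSpecified P f X T noise rhat muhat k .DR) ∧
        ((∀ t, ∀ᵐ ω ∂P, muhat t (X 0 ω) = f t (X 0 ω)) →
          MultiTreatment.WellSpecified P f X T noise rhat muhat k .DR ∧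
          MultiTreatment.WellSpecified P f X T noise rhat muhat k .X) ∧
        ∃ C : MultiTreatment.Learner → Matrix (Fin p) (Fin p) ℝ,
          -- unbiasedness and asymptotic covariance
          (∀ ℓ, MultiTreatment.WellSpecified P f X T noise rhat muhat k ℓ →
            MultiTreatment.Unbiased P φ X
              (MultiTreatment.betaHat f φ X T noise rhat muhat k ℓ) (β k - β 0) ∧
            MultiTreatment.HasAsymptoticCovariance P
              (MultiTreatment.betaHat f φ X T noise rhat muhat k ℓ) (β k - β 0) (C ℓ)) ∧
          -- M-learner
          ((∀ t, ∀ᵐ ω ∂P, rhat t (X 0 ω) = r t (X 0 ω)) →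
            ∀ B : ℝ, (∀ t, ∀ x ∈ D, |f t x| ≤ B) →
            ∀ i j, |C .M i j| ≤ c * ((B ^ 2 + (σ : ℝ) ^ 2) / rmin ^ (1 + ε))) ∧
          -- DR-learner
          ((∀ t, ∀ᵐ ω ∂P, rhat t (X 0 ω) = r t (X 0 ω)) →
            ∀ i j, |C .DR i j| ≤
              c * ((MultiTreatment.err P X f muhat k + MultiTreatment.err P X f muhat 0
                + (σ : ℝ) ^ 2) / rmin ^ (1 + ε))) ∧
          -- X-learner
          (MultiTreatment.WellSpecified P f X T noise rhat muhat k .X →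
            ∀ i j, |C .X i j| ≤
              c * ((K : ℝ) ^ 2 * ∑ l ∈ Finset.univ.erase k, MultiTreatment.err P X f muhat l
                + MultiTreatment.err P X f muhat k + (σ : ℝ) ^ 2)) := by
  -- The factor `(pLM)²` comes from the influence function and `18` from the residual bounds; adding
  -- `1` keeps the constant positive when the product is zero.
  refine ⟨(p * (L * M)) ^ 2 * 18 + 1, by positivity, ?_⟩
  intro Ω _ P _ d K D X T noise σ r rmin f φ β rhat muhat k h hM hF hL hN hk
  refine ⟨fun hr => ⟨h.wellSpecified_M_of_rhat hM hN hr, h.wellSpecified_DR_of_rhat hM hN hr⟩,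
    fun hμ => ⟨h.wellSpecified_DR_of_muhat hM hN hμ, h.wellSpecified_X_of_muhat hM hN hμ⟩, ?_⟩
  have hM0 : ∀ j, ∀ᵐ ω ∂P, |φ j (X 0 ω)| ≤ M := fun j => by
    filter_upwards [h.mem_D 0] with ω hω using hM j _ hω
  have hbound : ∀ (ℓ : MultiTreatment.Learner) (b : ℝ), 0 ≤ b →
      ∫ ω, MultiTreatment.LinearModel.residual X T noise φ β rhat muhat k ℓ 0 ω ^ 2 ∂P ≤ 18 * b →
      ∀ i j, |MultiTreatment.momentMatrix P (fun ω => MultiTreatment.CenteredErrors.influence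
        (MultiTreatment.secondMoment P φ X) φ (X 0 ω)
        (MultiTreatment.LinearModel.residual X T noise φ β rhat muhat k ℓ 0 ω)) i j| ≤
        ((p * (L * M)) ^ 2 * 18 + 1) * b := fun ℓ b hb hle i j => by
    refine (MultiTreatment.abs_momentMatrix_influence_le (h.memLp_residual hM hN ℓ).integrable_sq
      (ae_all_iff.2 hM0) hL i j).trans ?_
    nlinarith [mul_le_mul_of_nonneg_left hle (sq_nonneg ((p : ℝ) * (L * M)))]
  -- Since `rmin ≤ 1`, raising the exponent only weakens the bound.
  have hrpow : ∀ a : ℝ, 0 ≤ a → a / rmin ≤ a / rmin ^ (1 + ε) := fun a ha => by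
    refine div_le_div_of_nonneg_left ha (Real.rpow_pos_of_pos h.rmin_pos _) ?_
    simpa using Real.rpow_le_rpow_of_exponent_ge h.rmin_pos h.rmin_le_one
      (le_add_of_nonneg_right hε.le : (1 : ℝ) ≤ 1 + ε)
  have herr : ∀ t, 0 ≤ MultiTreatment.err P X f muhat t := fun t =>
    integral_nonneg fun _ => sq_nonneg _
  have hrpos := Real.rpow_pos_of_pos h.rmin_pos (1 + ε)
  refine ⟨fun ℓ => MultiTreatment.momentMatrix P fun ω => MultiTreatment.CenteredErrors.influence
    (MultiTreatment.secondMoment P φ X) φ (X 0 ω)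
    (MultiTreatment.LinearModel.residual X T noise φ β rhat muhat k ℓ 0 ω),
    fun ℓ hW => ?_, fun hr B hB => ?_, fun hr => ?_, fun _ => ?_⟩
  · have hC := h.centeredErrors_residual hM hN hW
    exact ⟨hC.unbiased_ols h.measurable_φ hM0 (h.Z_ae_eq ℓ),
      hC.hasAsymptoticCovariance_ols h.measurable_φ hM0 hF (h.Z_ae_eq ℓ)⟩
  · have hb : 0 ≤ B ^ 2 + (σ : ℝ) ^ 2 := by positivity
    exact hbound _ _ (by positivity) ((h.integral_residual_M_sq_le hM hN hk hr hB).trans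
      (mul_le_mul_of_nonneg_left (hrpow _ hb) (by norm_num)))
  · have hb : 0 ≤ MultiTreatment.err P X f muhat k + MultiTreatment.err P X f muhat 0 +
        (σ : ℝ) ^ 2 := by
      have := herr k
      have := herr 0
      positivity
    exact hbound _ _ (by positivity) ((h.integral_residual_DR_sq_le hM hN hk hr).trans
      (mul_le_mul_of_nonneg_left (hrpow _ hb) (by norm_num)))
  · have hS : 0 ≤ ∑ l ∈ Finset.univ.erase k, MultiTreatment.err P X f muhat l :=
      Finset.sum_nonneg fun l _ => herr l
    have hk0 := herr k
    -- A nonzero `k` in `Fin (K + 1)` forces `K ≥ 1`.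
    have hK : (1 : ℝ) ≤ (K : ℝ) ^ 2 := by
      have hK1 : 1 ≤ K := by
        have := k.isLt
        have := Fin.pos_iff_ne_zero.2 hk
        rw [Fin.lt_def] at this
        simp at this
        omega
      exact one_le_pow₀ (by exact_mod_cast hK1)
    refine hbound _ _ (by positivity) ((h.integral_residual_X_sq_le hM hN hk).trans ?_)
    have := le_mul_of_one_le_left hS hK
    linarith
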